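/- Let $q$ be a power of a prime $p$ and let $n\ge 1$. For $c=(a|b)\in\mathbb F_q^{2n}$ with $a,b\in\mathbb F_q^n$ let $\operatorname{swt}(c)=|\{i : (a_i,b_i)\neq(0,0)\}|$ be the symplectic weight, and let $\langle(a|b),(u|v)\rangle_{\rm S}=a\cdot v-b\cdot u$ be the symplectic inner product, with the corresponding dual $C^{\perp_{\rm S}}$ of a code $C$. For $S\subseteq\mathbb F_q^{2n}$ let $\operatorname{swt}(S)=\min\{\operatorname{swt}(x): x\in S,\ x\ne 0\}$ and $d_{\rm S}(S)=\min\{\operatorname{swt}(x-y): x,y\in S,\ x\neq y\}$; a minimum over the empty set is $n$ by convention. An $[\![N,K,d]\!]_q$ stabilizer code is a non-zero subspace $\mathcal Q$ of $(\mathbb C^q)^{\otimes N}$ of dimension $q^K$ that is the joint $+1$-eigenspace of a group of operators of the form $\gamma X(a)Z(b)$, $\gamma\in\mathbb C$, $a,b\in\mathbb F_q^N$, where $X(a)Z(b)|y\rangle=e^{2\pi i\operatorname{tr}(b\cdot y)/p}\,|y+a\rangle$ and $\operatorname{tr}$ is the absolute trace of $\mathbb F_q$; it is a stabilizer code of $D\subseteq\mathbb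 F_q^{2N}$ if $D$ is the set of the $(a|b)$ that occur in the group. Its minimum distance is the largest $d=d(\mathcal Q)$ such that every operator $E$ acting on at most $d-1$ of the tensor factors satisfies $PEP=\gamma_E P$ for a scalar $\gamma_E$, where $P$ is the orthogonal projection onto $\mathcal Q$; if $\dim\mathcal Q=1$, one requires in addition $\gamma_E=\operatorname{Tr}(E)/q^N$. **Theorem.** Let $C$ be an $\mathbb F_q$-linear code of length $2n$ and dimension $k$. Then $k-\dim(C\cap C^{\perp_{\rm S}})$ is an even number $2e$, and $k\le n+e$. There are $e$ symplectic pairs $z_i,w_i\in C$, $1\le i\le e$ (that is, $\langle z_i,z_j\rangle_{\rm S}=\langle w_i,w_j\rangle_{\rm S}=0$ and $\langle z_i,w_j\rangle_{\rm S}=\delta_{ij}$ for all $i,j$) which span a vector space complement of $C\cap C^{\perp_{\rm S}}$ in $C$, and there is an $[\![n+e,\,n-k+e,\,d(\mathcal Q)]\!]_q$ stabilizer code $\mathcal Q$, such that: 1. If $C^{\perp_{\rm S}}\not\subseteq C$ (equivalently $n-k+e>0$), then $$d(\mathcal Q)\ \ge\ \min\bigl\{\operatorname{swt}\bigl(C^{\perp_{\rm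 S}}\setminus(C\cap C^{\perp_{\rm S}})\bigr),\ \operatorname{swt}\bigl((C+C^{\perp_{\rm S}})\setminus C\bigr)+1\bigr\}.$$ 2. In all cases $$d(\mathcal Q)\ \ge\ \min\bigl\{d_{\rm S}(C^{\perp_{\rm S}}),\ d_{\rm S}(C+C^{\perp_{\rm S}})+1\bigr\},$$ and the right-hand side here is at most the right-hand side in 1. 3. In all cases $d(\mathcal Q)\ \le\ \operatorname{swt}\bigl(C^{\perp_{\rm S}}\setminus(C\cap C^{\perp_{\rm S}})\bigr)$. 4. Unless $n=1$ and $C=\mathbb F_q^{2}$, $\mathcal Q$ is a stabilizer code of the extension of $C$ in $\mathbb F_q^{2(n+e)}$ spanned by the vectors $(m_1,0\,|\,m_2,0)$ for $(m_1|m_2)\in C\cap C^{\perp_{\rm S}}$ and the vectors $(z_i',\delta_i\,|\,z_i'',0)$ and $(w_i',0\,|\,w_i'',-\delta_i)$ for $1\le i\le e$, where $z_i=(z_i'|z_i'')$, $w_i=(w_i'|w_i'')$ and $\delta_i$ is the $i$-th unit vector of $\mathbb F_q^e$. -/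

import Mathlib

/-! ### Codes in `F_q^{2n}` and the symplectic inner product -/

/-- `F^{2n}`; a vector `(a|b)` with `a, b ∈ F^n` is the pair `(a, b)`. -/
abbrev SympVec (F : Type*) (n : ℕ) : Type _ := (Fin n → F) × (Fin n → F)

/-- The symplectic inner product `⟨(a|b), (u|v)⟩ = a · v - b · u`. -/
def sympInner {F : Type*} [Field F] {n : ℕ} (x y : SympVec F n) : F :=
  x.1 ⬝ᵥ y.2 - x.2 ⬝ᵥ y.1

/-- The symplectic dual of a linear code. -/
def sympDual {F : Type*} [Field F] {n : ℕ} (C : Submodule F (SympVec F n)) :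
    Submodule F (SympVec F n) where
  carrier := {y | ∀ x ∈ C, sympInner x y = 0}
  zero_mem' := by
    intro x _
    simp [sympInner]
  add_mem' := by
    intro y z hy hz x hx
    have h1 := hy x hx
    have h2 := hz x hx
    simp only [sympInner, Prod.fst_add, Prod.snd_add, dotProduct_add] at h1 h2 ⊢
    linear_combination h1 + h2
  smul_mem' := by
    intro c y hy x hx
    have h1 := hy x hx
    simp only [sympInner, Prod.smul_fst, Prod.smul_snd, dotProduct_smul, smul_eq_mul] at h1 ⊢
    linear_combination c * h1

/-- The symplectic hull `C ∩ C^⊥`. -/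
def sympHull {F : Type*} [Field F] {n : ℕ} (C : Submodule F (SympVec F n)) :
    Submodule F (SympVec F n) := C ⊓ sympDual C

/-- The symplectic weight of a vector: the number of `i` with `(a_i, b_i) ≠ (0, 0)`. -/
def swt {F : Type*} [Field F] [DecidableEq F] {n : ℕ} (x : SympVec F n) : ℕ :=
  (Finset.univ.filter fun i : Fin n => (x.1 i, x.2 i) ≠ (0, 0)).card

open Classical in
/-- The minimum of a set of weights; by convention it is the length `n` when the set is empty. -/
noncomputable def minOrLength (n : ℕ) (W : Set ℕ) : ℕ :=
  if W.Nonempty then sInf W else n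

/-- The minimum symplectic weight of the non-zero vectors of `S` (and `n` if there are none). -/
noncomputable def swtSet {F : Type*} [Field F] [DecidableEq F] {n : ℕ}
    (S : Set (SympVec F n)) : ℕ :=
  minOrLength n {w | ∃ x ∈ S, x ≠ 0 ∧ swt x = w}

/-- The symplectic minimum distance of `S` (and `n` if `S` has no two distinct elements). -/
noncomputable def sympDist {F : Type*} [Field F] [DecidableEq F] {n : ℕ}
    (S : Set (SympVec F n)) : ℕ :=
  minOrLength n {w | ∃ x ∈ S, ∃ y ∈ S, x ≠ y ∧ swt (x - y) = w}

/-- The vectors `z i, w i` (for `i < e`) form `e` symplectic pairs. The value `-1` of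
`⟨w i, z i⟩` is forced by antisymmetry. -/
def IsSymplecticPairs {F : Type*} [Field F] {n e : ℕ} (z w : Fin e → SympVec F n) : Prop :=
  ∀ i j, sympInner (z i) (z j) = 0 ∧ sympInner (w i) (w j) = 0 ∧
    sympInner (z i) (w j) = if i = j then 1 else 0

/-- Append `e` coordinates to each half: `(a|b), (s|t) ↦ (a,s|b,t)`. -/
def appendVec {F : Type*} {n e : ℕ} (x : SympVec F n) (y : SympVec F e) :
    SympVec F (n + e) :=
  (Fin.append x.1 y.1, Fin.append x.2 y.2)

/-- The extension of length `2(n+e)` spanned by the rows `(m₁,0|m₂,0)` for `m` in the code `M`,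
`(z_i, δ_i|z_i', 0)` and `(w_i, 0|w_i', -δ_i)` for `i < e`, where `δ_i` is the `i`-th unit
vector. -/
def sympExtension {F : Type*} [Field F] {n e : ℕ} (M : Submodule F (SympVec F n))
    (z w : Fin e → SympVec F n) : Submodule F (SympVec F (n + e)) :=
  Submodule.span F
    ({v | ∃ m ∈ M, v = appendVec m 0} ∪
      {v | ∃ i, v = appendVec (z i) (Pi.single i 1, 0)} ∪
      {v | ∃ i, v = appendVec (w i) (0, -Pi.single i 1)})

/-! ### Quantum codes

The space `(ℂ^q)^{⊗N}` is the space of functions `F^N → ℂ`: its standard basis vectors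
`|x_1⟩ ⊗ ⋯ ⊗ |x_N⟩` are indexed by `x ∈ F^N`, and the Hermitian inner product of `u` and `v` is
`star u ⬝ᵥ v`. Operators are square matrices indexed by `F^N`. -/

/-- The space `(ℂ^q)^{⊗N}`, where the basis of `ℂ^q` is labelled by the field `F`. -/
abbrev QSpace (F : Type*) (N : ℕ) : Type _ := (Fin N → F) → ℂ

/-- Operators on `(ℂ^q)^{⊗N}`. -/
abbrev QOp (F : Type*) (N : ℕ) : Type _ := Matrix (Fin N → F) (Fin N → F) ℂ

/-- The operator `X(a)Z(b) : |y⟩ ↦ ω^{tr(b · y)} |y + a⟩` attached to `(a|b)`, where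
`ω = exp(2πi/p)` and `tr` is the absolute trace of `F` over `F_p`. -/
noncomputable def weylOp (p : ℕ) [Fact p.Prime] {F : Type*} [Field F] [Fintype F]
    [DecidableEq F] [Algebra (ZMod p) F] {N : ℕ} (c : SympVec F N) : QOp F N :=
  Matrix.of fun x y =>
    if x = y + c.1 then (ZMod.stdAddChar (Algebra.trace (ZMod p) F (c.2 ⬝ᵥ y)) : ℂ) else 0

/-- `Q` is a stabilizer code: it is non-zero and it is the joint `+1`-eigenspace of a group `S`
of operators of the form `γ X(a)Z(b)` with scalars `γ`; the set of the `(a|b)` which occur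
is `D`. (As `Q` is non-zero, only roots of unity can occur as the scalars `γ`.) -/
def IsStabilizerCodeOf (p : ℕ) [Fact p.Prime] {F : Type*} [Field F] [Fintype F]
    [DecidableEq F] [Algebra (ZMod p) F] {N : ℕ} (D : Set (SympVec F N))
    (Q : Submodule ℂ (QSpace F N)) : Prop :=
  Q ≠ ⊥ ∧ ∃ S : Subgroup (QOp F N)ˣ,
    (∀ U ∈ S, ∃ c ∈ D, ∃ γ : ℂ, (U : QOp F N) = γ • weylOp p c) ∧
    (∀ c ∈ D, ∃ U ∈ S, ∃ γ : ℂ, (U : QOp F N) = γ • weylOp p c) ∧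
    ∀ v : QSpace F N, v ∈ Q ↔ ∀ U ∈ S, (U : QOp F N).mulVec v = v

/-- The operator `E` acts on the tensor factors in `T` only, i.e. `E = A_T ⊗ 1`. -/
def ActsOn {F : Type*} [Fintype F] [DecidableEq F] {N : ℕ} (T : Finset (Fin N))
    (E : QOp F N) : Prop :=
  ∃ A : Matrix (T → F) (T → F) ℂ, ∀ x y : Fin N → F,
    E x y = if ∀ i, i ∉ T → x i = y i then A (fun i => x i) (fun i => y i) else 0

/-- The error `E` can be detected by `Q` or has no effect on it: `P E P = γ P` for a scalar `γ`,
where `P` is the orthogonal projection onto `Q`. For a one-dimensional code, where this would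
always hold, the usual convention is imposed: `γ` has to be the normalized trace of `E`, that is,
non-trivial errors of trace zero have to move `Q` to an orthogonal space. -/
def Detects {F : Type*} [Fintype F] [DecidableEq F] {N : ℕ} (Q : Submodule ℂ (QSpace F N))
    (E : QOp F N) : Prop :=
  ∃ γ : ℂ, (∀ u ∈ Q, ∀ v ∈ Q, star u ⬝ᵥ E.mulVec v = γ * (star u ⬝ᵥ v)) ∧
    (Module.finrank ℂ Q = 1 → γ = E.trace / (Fintype.card (Fin N → F) : ℂ))

/-- `d` is the minimum distance of `Q`: the largest `d` such that every error acting on at most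
`d - 1` tensor factors can be detected or has no effect. -/
def IsQuantumMinDist {F : Type*} [Fintype F] [DecidableEq F] {N : ℕ}
    (Q : Submodule ℂ (QSpace F N)) (d : ℕ) : Prop :=
  IsGreatest {d : ℕ | ∀ T : Finset (Fin N), T.card < d → ∀ E : QOp F N,
    ActsOn T E → Detects Q E} d

/-! ### Symplectic linear algebra -/

/-! Symplectic Gram–Schmidt writes `C` as the direct sum of its hull and the span of `e` symplectic
pairs. Appending to each vector `x` its coefficients along the pairs, with one half negated, gives a
linear map `φ = extendVec z w` on all of `F^{2n}`, not only on `C`. On `C` the appended part cancels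
the form, so `φ(C)`, which is the extension in the statement, is self-orthogonal. The key identity
`sympDual_map_extendVec` says `φ(C)^⊥ = φ(C + C^⊥)`.

A self-orthogonal `D` of length `2N` gives commuting Weyl operators. Suitable phases turn them into
a group, and the average of this group projects onto a code of dimension `q^(N - dim D)`. Weyl
operators span all local operators, so the distance is the least weight of an undetected `c`
(`isQuantumMinDist_of_isLeast`). By `IsPhase.detects_weylOp_iff` these are the non-zero `c ∈ D^⊥`,
with `c ∈ D` admitted only for a one-dimensional code.

The theorem thus becomes a weight count for `φ(x)`, `x ∈ C + C^⊥`: if `x ∈ C^⊥` the appended part is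
zero and the weight is unchanged; otherwise it is non-zero and the weight grows by at least one. The
default value `n` needs care only for `C = F^{2n}`, where standard pairs are chosen, and for `n = 1`
the code is replaced. -/

theorem exists_eq_appendVec {F : Type*} {n e : ℕ} (c : SympVec F (n + e)) :
    ∃ (x : SympVec F n) (s : SympVec F e), c = appendVec x s :=
  ⟨(fun i => c.1 (Fin.castAdd e i), fun i => c.2 (Fin.castAdd e i)),
    (fun i => c.1 (Fin.natAdd n i), fun i => c.2 (Fin.natAdd n i)),
    Prod.ext Fin.append_castAdd_natAdd.symm Fin.append_castAdd_natAdd.symm⟩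

theorem appendVec_inj {F : Type*} {n e : ℕ} {x y : SympVec F n} {s t : SympVec F e} :
    appendVec x s = appendVec y t ↔ x = y ∧ s = t := by
  refine ⟨fun h => ?_, fun h => by rw [h.1, h.2]⟩
  have h1 := congrFun (congrArg Prod.fst h)
  have h2 := congrFun (congrArg Prod.snd h)
  refine ⟨?_, ?_⟩
  · ext i
    · simpa [appendVec] using h1 (Fin.castAdd e i)
    · simpa [appendVec] using h2 (Fin.castAdd e i)
  · ext i
    · simpa [appendVec] using h1 (Fin.natAdd n i)
    · simpa [appendVec] using h2 (Fin.natAdd n i)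

section SymplecticAlgebra

variable {F : Type*} [Field F] {n e : ℕ}

theorem sympInner_add_left (x y z : SympVec F n) :
    sympInner (x + y) z = sympInner x z + sympInner y z := by
  simp only [sympInner, Prod.fst_add, Prod.snd_add, add_dotProduct]; ring

theorem sympInner_add_right (x y z : SympVec F n) :
    sympInner x (y + z) = sympInner x y + sympInner x z := by
  simp only [sympInner, Prod.fst_add, Prod.snd_add, dotProduct_add]; ring

theorem sympInner_smul_left (c : F) (x y : SympVec F n) :
    sympInner (c • x) y = c * sympInner x y := by
  simp only [sympInner, Prod.smul_fst, Prod.smul_snd, smul_dotProduct, smul_eq_mul]; ring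

theorem sympInner_smul_right (c : F) (x y : SympVec F n) :
    sympInner x (c • y) = c * sympInner x y := by
  simp only [sympInner, Prod.smul_fst, Prod.smul_snd, dotProduct_smul, smul_eq_mul]; ring

theorem sympInner_swap (x y : SympVec F n) : sympInner x y = -sympInner y x := by
  simp only [sympInner, dotProduct_comm x.1, dotProduct_comm x.2]; ring

theorem sympInner_self (x : SympVec F n) : sympInner x x = 0 := by
  simp only [sympInner, dotProduct_comm x.1, sub_self]

theorem sympInner_zero_right (x : SympVec F n) : sympInner x 0 = 0 := by
  simp [sympInner]

/-- The symplectic inner product as a bilinear form. -/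
def sympForm (F : Type*) [Field F] (n : ℕ) : LinearMap.BilinForm F (SympVec F n) :=
  LinearMap.mk₂ F sympInner sympInner_add_left sympInner_smul_left sympInner_add_right
    sympInner_smul_right

@[simp] theorem sympForm_apply (x y : SympVec F n) : sympForm F n x y = sympInner x y := rfl

theorem mem_sympDual {C : Submodule F (SympVec F n)} {y : SympVec F n} :
    y ∈ sympDual C ↔ ∀ x ∈ C, sympInner x y = 0 := Iff.rfl

theorem mem_sympDual_span {s : Set (SympVec F n)} {y : SympVec F n} :
    y ∈ sympDual (Submodule.span F s) ↔ ∀ x ∈ s, sympInner x y = 0 := by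
  refine ⟨fun h x hx => h x (Submodule.subset_span hx), fun h x hx => ?_⟩
  induction hx using Submodule.span_induction with
  | mem x hx => exact h x hx
  | zero => rw [sympInner_swap, sympInner_zero_right, neg_zero]
  | add x z _ _ hx hz => rw [sympInner_add_left, hx, hz, add_zero]
  | smul c x _ hx => rw [sympInner_smul_left, hx, mul_zero]

theorem sympForm_ker : (sympForm F n).ker = ⊥ := by
  rw [LinearMap.ker_eq_bot']
  intro x hx
  have h (y : SympVec F n) : sympInner x y = 0 := by rw [← sympForm_apply, hx]; rfl
  ext i
  · simpa [sympInner] using h (0, Pi.single i 1)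
  · simpa [sympInner] using h (Pi.single i 1, 0)

theorem finrank_add_finrank_sympDual (C : Submodule F (SympVec F n)) :
    Module.finrank F C + Module.finrank F (sympDual C) = 2 * n := by
  have h := LinearMap.BilinForm.finrank_add_finrank_orthogonal' (B := sympForm F n) C
  rw [sympForm_ker, inf_bot_eq, finrank_bot, Module.finrank_prod, Module.finrank_fin_fun] at h
  rw [two_mul, ← add_zero (n + n), ← h]
  rfl

theorem sympDual_antitone {C D : Submodule F (SympVec F n)} (h : C ≤ D) :
    sympDual D ≤ sympDual C := fun _ hy x hx => hy x (h hx)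

theorem le_sympDual_sympHull (C : Submodule F (SympVec F n)) :
    C ≤ sympDual (sympHull C) := by
  intro x hx y hy
  rw [sympInner_swap, hy.2 x hx, neg_zero]

/-! ### Symplectic pairs -/

/-- The vector `∑ s i • z i + ∑ t i • w i` with coefficient vector `(s|t)`. -/
def pairComb (z w : Fin e → SympVec F n) : SympVec F e →ₗ[F] SympVec F n :=
  (Fintype.linearCombination F z).coprod (Fintype.linearCombination F w)

theorem pairComb_apply (z w : Fin e → SympVec F n) (x : SympVec F e) :
    pairComb z w x = ∑ i, x.1 i • z i + ∑ i, x.2 i • w i := rfl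

/-- The coefficients of the part of a vector that lies in the span of the pairs `z i, w i`. -/
def pairCoeff (z w : Fin e → SympVec F n) : SympVec F n →ₗ[F] SympVec F e where
  toFun x := (fun i => -sympInner (w i) x, fun i => sympInner (z i) x)
  map_add' x y := by
    ext i <;> simp [sympInner_add_right]; ring
  map_smul' c x := by
    ext i <;> simp [sympInner_smul_right]

theorem range_pairComb (z w : Fin e → SympVec F n) :
    LinearMap.range (pairComb z w) = Submodule.span F (Set.range z ∪ Set.range w) := by
  rw [pairComb, LinearMap.range_coprod, Fintype.range_linearCombination,
    Fintype.range_linearCombination, Submodule.span_union]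

theorem sympInner_sum_right {ι : Type*} (s : Finset ι) (x : SympVec F n) (y : ι → SympVec F n) :
    sympInner x (∑ i ∈ s, y i) = ∑ i ∈ s, sympInner x (y i) := by
  simp only [← sympForm_apply, map_sum]

theorem pairCoeff_pairComb {z w : Fin e → SympVec F n} (h : IsSymplecticPairs z w)
    (x : SympVec F e) : pairCoeff z w (pairComb z w x) = x := by
  have h' (i j) : sympInner (w i) (z j) = -if j = i then 1 else 0 := by
    rw [sympInner_swap, (h j i).2.2]
  ext i <;> simp [pairCoeff, pairComb_apply, sympInner_add_right, sympInner_sum_right,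
    sympInner_smul_right, h', fun i j => (h i j).1, fun i j => (h i j).2.1,
    fun i j => (h i j).2.2]

theorem finrank_span_pairs {z w : Fin e → SympVec F n} (h : IsSymplecticPairs z w) :
    Module.finrank F (Submodule.span F (Set.range z ∪ Set.range w)) = 2 * e := by
  rw [← range_pairComb, LinearMap.finrank_range_of_inj
    (Function.LeftInverse.injective (pairCoeff_pairComb h)), Module.finrank_prod,
    Module.finrank_fin_fun, two_mul]

theorem pairCoeff_eq_zero {C : Submodule F (SympVec F n)} {z w : Fin e → SympVec F n}
    (hz : ∀ i, z i ∈ C) (hw : ∀ i, w i ∈ C) {x : SympVec F n} (hx : x ∈ sympDual C) :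
    pairCoeff z w x = 0 := by
  ext i
  · simp [pairCoeff, hx _ (hw i)]
  · simp [pairCoeff, hx _ (hz i)]

theorem disjoint_span_pairs_sympHull {C : Submodule F (SympVec F n)}
    {z w : Fin e → SympVec F n} (h : IsSymplecticPairs z w) (hz : ∀ i, z i ∈ C)
    (hw : ∀ i, w i ∈ C) :
    Disjoint (Submodule.span F (Set.range z ∪ Set.range w)) (sympHull C) := by
  rw [Submodule.disjoint_def, ← range_pairComb]
  rintro _ ⟨x, rfl⟩ hx
  rw [← pairCoeff_pairComb h x, pairCoeff_eq_zero hz hw hx.2, map_zero]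

/-- Symplectic Gram–Schmidt, by induction on the dimension: a code that is not self-orthogonal
contains a hyperbolic plane, and the induction continues in the orthogonal complement of this plane
inside the code. -/
theorem exists_symplecticPairs (C : Submodule F (SympVec F n)) :
    ∃ (e : ℕ) (z w : Fin e → SympVec F n), IsSymplecticPairs z w ∧
      (∀ i, z i ∈ C) ∧ (∀ i, w i ∈ C) ∧
      C ≤ Submodule.span F (Set.range z ∪ Set.range w) ⊔ sympHull C := by
  induction hk : Module.finrank F C using Nat.strong_induction_on generalizing C with
  | _ k ih =>
    by_cases hC : C ≤ sympDual C
    · refine ⟨0, Fin.elim0, Fin.elim0, fun i => i.elim0, fun i => i.elim0, fun i => i.elim0, ?_⟩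
      exact le_sup_of_le_right (le_inf le_rfl hC)
    · obtain ⟨w₀, hw₀, hC⟩ := Set.not_subset.1 hC
      simp only [SetLike.mem_coe, mem_sympDual, not_forall] at hC
      obtain ⟨z₁, hz₁, hne⟩ := hC
      obtain ⟨z₀, hz₀, hzw⟩ : ∃ z₀ ∈ C, sympInner z₀ w₀ = 1 :=
        ⟨(sympInner z₁ w₀)⁻¹ • z₁, C.smul_mem _ hz₁, by
          rw [sympInner_smul_left, inv_mul_cancel₀ hne]⟩
      have hwz : sympInner w₀ z₀ = -1 := by rw [sympInner_swap, hzw]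
      let C' := C ⊓ sympDual (Submodule.span F {z₀, w₀})
      have hmem {x} : x ∈ C' ↔ x ∈ C ∧ sympInner z₀ x = 0 ∧ sympInner w₀ x = 0 := by
        simp only [C', Submodule.mem_inf, mem_sympDual_span]
        simp
      -- The projection of `C` onto `C'` along the plane; the signs come from `⟨w₀, z₀⟩ = -1`.
      have hdec {x} (hx : x ∈ C) :
          x + sympInner w₀ x • z₀ - sympInner z₀ x • w₀ ∈ C' := by
        rw [hmem]
        refine ⟨C.sub_mem (C.add_mem hx (C.smul_mem _ hz₀)) (C.smul_mem _ hw₀), ?_, ?_⟩ <;>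
        · rw [sub_eq_add_neg, ← neg_smul]
          simp only [sympInner_add_right, sympInner_smul_right, sympInner_self, hzw, hwz]
          ring
      have hlt : Module.finrank F C' < k := by
        rw [← hk]
        refine Submodule.finrank_lt_finrank_of_lt (lt_of_le_of_ne inf_le_left fun heq => ?_)
        have := hmem.1 (heq.symm ▸ hw₀)
        exact one_ne_zero (hzw.symm.trans this.2.1)
      obtain ⟨e, z, w, hp, hz, hw, hle⟩ := ih _ hlt C' rfl
      have hz' i := hmem.1 (hz i)
      have hw' i := hmem.1 (hw i)
      refine ⟨e + 1, Fin.cons z₀ z, Fin.cons w₀ w, ?_, ?_, ?_, ?_⟩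
      · intro i j
        refine Fin.cases ?_ (fun i => ?_) i <;> refine Fin.cases ?_ (fun j => ?_) j
        · simp [sympInner_self, hzw]
        · simp [hz', hw', (Fin.succ_ne_zero _).symm]
        · simp only [Fin.cons_zero, Fin.cons_succ]
          rw [sympInner_swap _ z₀, sympInner_swap _ w₀, sympInner_swap _ w₀]
          simp [hz', hw']
        · simpa using hp i j
      · exact Fin.cases hz₀ fun i => (hz' i).1
      · exact Fin.cases hw₀ fun i => (hw' i).1
      -- A vector of the hull of `C'` is orthogonal to `C'` and to the plane, and by `hdec` these
      -- two span `C`.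
      · have hhull : sympHull C' ≤ sympHull C := by
          intro x hx
          refine ⟨(hmem.1 hx.1).1, fun y hy => ?_⟩
          have h1 := hx.2 _ (hdec hy)
          rw [sub_eq_add_neg, ← neg_smul, sympInner_add_left, sympInner_add_left,
            sympInner_smul_left, sympInner_smul_left, (hmem.1 hx.1).2.1, (hmem.1 hx.1).2.2] at h1
          simpa using h1
        rw [Fin.range_cons, Fin.range_cons]
        intro x hx
        have hsub : Submodule.span F (Set.range z ∪ Set.range w) ≤
            Submodule.span F (insert z₀ (Set.range z) ∪ insert w₀ (Set.range w)) :=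
          Submodule.span_mono
            (Set.union_subset_union (Set.subset_insert _ _) (Set.subset_insert _ _))
        have h1 := sup_le_sup hsub hhull (hle (hdec hx))
        have h2 : z₀ ∈ Submodule.span F (insert z₀ (Set.range z) ∪ insert w₀ (Set.range w)) :=
          Submodule.subset_span (by simp)
        have h3 : w₀ ∈ Submodule.span F (insert z₀ (Set.range z) ∪ insert w₀ (Set.range w)) :=
          Submodule.subset_span (by simp)
        have h4 := Submodule.sub_mem _ h1 (Submodule.smul_mem _ (sympInner w₀ x)
          (Submodule.mem_sup_left (T := sympHull C) h2))
        have h5 := Submodule.add_mem _ h4 (Submodule.smul_mem _ (sympInner z₀ x)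
          (Submodule.mem_sup_left (T := sympHull C) h3))
        convert h5 using 1
        abel

/-- The coefficients are, up to sign, the inner products with the pairs, and the pairs together with
the hull generate `C`. This is also what forces the weight to grow outside `C^⊥`. -/
theorem mem_sympDual_of_pairCoeff_eq_zero {C : Submodule F (SympVec F n)}
    {z w : Fin e → SympVec F n}
    (hC : Submodule.span F (Set.range z ∪ Set.range w) ⊔ sympHull C = C) {y : SympVec F n}
    (hy : y ∈ sympDual (sympHull C)) (hc : pairCoeff z w y = 0) : y ∈ sympDual C := by
  intro c hcC
  rw [← hC] at hcC
  obtain ⟨a, ha, b, hb, rfl⟩ := Submodule.mem_sup.1 hcC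
  have h1 : y ∈ sympDual (Submodule.span F (Set.range z ∪ Set.range w)) := by
    rw [mem_sympDual_span]
    rintro _ (⟨i, rfl⟩ | ⟨i, rfl⟩)
    · exact congrFun (congrArg Prod.snd hc) i
    · exact neg_eq_zero.1 (congrFun (congrArg Prod.fst hc) i)
  rw [sympInner_add_left, h1 a ha, hy b hb, add_zero]

/-- Subtracting from a vector orthogonal to the hull its component along the pairs leaves a vector
with zero coefficients, hence one in `C^⊥`. -/
theorem sympDual_sympHull {C : Submodule F (SympVec F n)} {z w : Fin e → SympVec F n}
    (h : IsSymplecticPairs z w)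
    (hC : Submodule.span F (Set.range z ∪ Set.range w) ⊔ sympHull C = C) :
    sympDual (sympHull C) = C ⊔ sympDual C := by
  have hspan : Submodule.span F (Set.range z ∪ Set.range w) ≤ C := le_sup_left.trans hC.le
  have hP (x : SympVec F e) : pairComb z w x ∈ C :=
    hspan (range_pairComb z w ▸ LinearMap.mem_range_self _ _)
  refine le_antisymm (fun x hx => ?_)
    (sup_le (le_sympDual_sympHull C) (sympDual_antitone inf_le_left))
  rw [← add_sub_cancel (pairComb z w (pairCoeff z w x)) x]
  refine Submodule.add_mem_sup (hP _) (mem_sympDual_of_pairCoeff_eq_zero hC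
    (Submodule.sub_mem _ hx (le_sympDual_sympHull C (hP _))) ?_)
  rw [map_sub, pairCoeff_pairComb h, sub_self]

theorem finrank_eq_add_two_mul {C : Submodule F (SympVec F n)} {z w : Fin e → SympVec F n}
    (h : IsSymplecticPairs z w)
    (hC : Submodule.span F (Set.range z ∪ Set.range w) ⊔ sympHull C = C) :
    Module.finrank F C = Module.finrank F (sympHull C) + 2 * e := by
  have hspan : Submodule.span F (Set.range z ∪ Set.range w) ≤ C := le_sup_left.trans hC.le
  have h3 := Submodule.finrank_sup_add_finrank_inf_eq
    (Submodule.span F (Set.range z ∪ Set.range w)) (sympHull C)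
  rw [(disjoint_span_pairs_sympHull h
    (fun i => hspan (Submodule.subset_span (Or.inl ⟨i, rfl⟩)))
    (fun i => hspan (Submodule.subset_span (Or.inr ⟨i, rfl⟩)))).eq_bot, hC, finrank_bot,
    finrank_span_pairs h] at h3
  omega

/-! ### The extension of a code by its symplectic pairs -/

theorem sympInner_appendVec (x y : SympVec F n) (s t : SympVec F e) :
    sympInner (appendVec x s) (appendVec y t) = sympInner x y + sympInner s t := by
  simp only [sympInner, appendVec, dotProduct, Fin.sum_univ_add, Fin.append_left,
    Fin.append_right]
  ring

/-- The linear map `x ↦ (x, s|t)` where `(s|-t)` are the coefficients of `x` with respect to the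
pairs `z i, w i`. -/
def extendVec (z w : Fin e → SympVec F n) : SympVec F n →ₗ[F] SympVec F (n + e) where
  toFun x := appendVec x ((pairCoeff z w x).1, -(pairCoeff z w x).2)
  map_add' x y := by
    ext i <;> refine Fin.addCases (fun i => ?_) (fun i => ?_) i <;> simp [appendVec]
    ring
  map_smul' c x := by
    ext i <;> refine Fin.addCases (fun i => ?_) (fun i => ?_) i <;> simp [appendVec]

theorem extendVec_apply (z w : Fin e → SympVec F n) (x : SympVec F n) :
    extendVec z w x = appendVec x ((pairCoeff z w x).1, -(pairCoeff z w x).2) := rfl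

theorem extendVec_injective (z w : Fin e → SympVec F n) : Function.Injective (extendVec z w) :=
  fun _ _ h => (appendVec_inj.1 h).1

theorem finrank_map_extendVec (z w : Fin e → SympVec F n) (C : Submodule F (SympVec F n)) :
    Module.finrank F (C.map (extendVec z w)) = Module.finrank F C :=
  (Submodule.equivMapOfInjective _ (extendVec_injective z w) C).finrank_eq.symm

theorem extendVec_eq_of_pairCoeff_eq_zero {z w : Fin e → SympVec F n} {x : SympVec F n}
    (h : pairCoeff z w x = 0) : extendVec z w x = appendVec x 0 := by
  rw [extendVec_apply, h]; simp [← Prod.zero_eq_mk]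

theorem extendVec_left {z w : Fin e → SympVec F n} (h : IsSymplecticPairs z w) (i : Fin e) :
    extendVec z w (z i) = appendVec (z i) (Pi.single i 1, 0) := by
  have h1 : z i = pairComb z w (Pi.single i 1, 0) := by simp [pairComb_apply, Pi.single_apply]
  rw [extendVec_apply]
  conv_lhs => enter [2]; rw [h1, pairCoeff_pairComb h]
  simp

theorem extendVec_right {z w : Fin e → SympVec F n} (h : IsSymplecticPairs z w) (i : Fin e) :
    extendVec z w (w i) = appendVec (w i) (0, -Pi.single i 1) := by
  have h1 : w i = pairComb z w (0, Pi.single i 1) := by simp [pairComb_apply, Pi.single_apply]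
  rw [extendVec_apply]
  conv_lhs => enter [2]; rw [h1, pairCoeff_pairComb h]

/-- Hull vectors have zero coefficients and the pairs have unit vectors as coefficients, so the
generators of the extension are the images of a spanning set of `C`. -/
theorem sympExtension_sympHull {C : Submodule F (SympVec F n)} {z w : Fin e → SympVec F n}
    (h : IsSymplecticPairs z w)
    (hC : Submodule.span F (Set.range z ∪ Set.range w) ⊔ sympHull C = C) :
    sympExtension (sympHull C) z w = C.map (extendVec z w) := by
  have hspan : Submodule.span F (Set.range z ∪ Set.range w) ≤ C := le_sup_left.trans hC.le
  have hz i : z i ∈ C := hspan (Submodule.subset_span (Or.inl ⟨i, rfl⟩))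
  have hw i : w i ∈ C := hspan (Submodule.subset_span (Or.inr ⟨i, rfl⟩))
  have hset : {v | ∃ m ∈ sympHull C, v = appendVec m 0} ∪
      {v | ∃ i, v = appendVec (z i) (Pi.single i 1, 0)} ∪
      {v | ∃ i, v = appendVec (w i) (0, -Pi.single i 1)} =
      extendVec z w '' ((Set.range z ∪ Set.range w) ∪ sympHull C) := by
    rw [Set.image_union, Set.image_union, Set.union_assoc, Set.union_comm]
    congr 1
    · simp only [← Set.range_comp, Function.comp_def, extendVec_left h, extendVec_right h]
      congr 1 <;> ext v <;> simp only [Set.mem_ofPred_eq, Set.mem_range, eq_comm]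
    · ext v
      refine exists_congr fun m => and_congr_right fun hm => ?_
      rw [extendVec_eq_of_pairCoeff_eq_zero (pairCoeff_eq_zero hz hw hm.2), eq_comm]
  rw [sympExtension, hset, ← Submodule.map_span, Submodule.span_union, Submodule.span_eq, hC]

/-- Orthogonality to the images of the hull constrains only the first `n` positions; orthogonality
to the images of the pairs then determines the appended coordinates. The resulting inclusion is an
equality by dimension, as `2(n+e) - k = 2n - (k - 2e)`. -/
theorem sympDual_map_extendVec {C : Submodule F (SympVec F n)} {z w : Fin e → SympVec F n}
    (h : IsSymplecticPairs z w)
    (hC : Submodule.span F (Set.range z ∪ Set.range w) ⊔ sympHull C = C) :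
    sympDual (C.map (extendVec z w)) = (C ⊔ sympDual C).map (extendVec z w) := by
  have hspan : Submodule.span F (Set.range z ∪ Set.range w) ≤ C := le_sup_left.trans hC.le
  have hz i : z i ∈ C := hspan (Submodule.subset_span (Or.inl ⟨i, rfl⟩))
  have hw i : w i ∈ C := hspan (Submodule.subset_span (Or.inr ⟨i, rfl⟩))
  rw [← sympDual_sympHull h hC]
  have hle : sympDual (C.map (extendVec z w)) ≤
      (sympDual (sympHull C)).map (extendVec z w) := by
    intro c hc
    obtain ⟨x, s, rfl⟩ := exists_eq_appendVec c
    refine ⟨x, fun m hm => ?_, ?_⟩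
    · have := hc _ (Submodule.mem_map_of_mem hm.1)
      rw [extendVec_eq_of_pairCoeff_eq_zero (pairCoeff_eq_zero hz hw hm.2),
        sympInner_appendVec] at this
      simpa [sympInner] using this
    · rw [extendVec_apply, appendVec_inj]
      refine ⟨rfl, ?_⟩
      ext i
      · have := hc _ (Submodule.mem_map_of_mem (hw i))
        rw [extendVec_right h, sympInner_appendVec] at this
        simp only [sympInner, zero_dotProduct, neg_dotProduct, single_dotProduct, one_mul] at this
        simp only [pairCoeff, LinearMap.coe_mk, AddHom.coe_mk, sympInner]
        linear_combination -this
      · have := hc _ (Submodule.mem_map_of_mem (hz i))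
        rw [extendVec_left h, sympInner_appendVec] at this
        simp only [sympInner, zero_dotProduct, single_dotProduct, one_mul] at this
        simp only [pairCoeff, LinearMap.coe_mk, AddHom.coe_mk, sympInner, Pi.neg_apply]
        linear_combination -this
  refine Submodule.eq_of_le_of_finrank_eq hle ?_
  have h1 := finrank_add_finrank_sympDual (C.map (extendVec z w))
  have h2 := finrank_add_finrank_sympDual (sympHull C)
  have h3 := finrank_eq_add_two_mul h hC
  rw [finrank_map_extendVec] at h1 ⊢
  omega

end SymplecticAlgebra

/-! ### Joint eigenvectors -/

/-- A joint eigenspace of some of the operators is invariant under the next one, because they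
commute, so the next one has an eigenvector inside it. -/
theorem Module.End.exists_joint_eigenvector {K V ι : Type*} [Field K] [IsAlgClosed K]
    [AddCommGroup V] [Module K V] [FiniteDimensional K V] [Nontrivial V] (f : ι → Module.End K V)
    (hf : ∀ i j, Commute (f i) (f j)) (s : Finset ι) :
    ∃ χ : ι → K, ∃ v : V, v ≠ 0 ∧ ∀ i ∈ s, f i v = χ i • v := by
  classical
  suffices ∃ χ : ι → K, (⨅ i ∈ s, (f i).eigenspace (χ i)) ≠ ⊥ by
    obtain ⟨χ, hχ⟩ := this
    obtain ⟨v, hv, hv0⟩ := Submodule.exists_mem_ne_zero_of_ne_bot hχ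
    simp only [Submodule.mem_iInf, Module.End.mem_eigenspace_iff] at hv
    exact ⟨χ, v, hv0, hv⟩
  induction s using Finset.induction_on with
  | empty => exact ⟨0, by simp⟩
  | insert j s hj ih =>
    obtain ⟨χ, hχ⟩ := ih
    set W := ⨅ i ∈ s, (f i).eigenspace (χ i) with hW
    have hinv : ∀ x ∈ W, f j x ∈ W := by
      intro x hx
      simp only [hW, Submodule.mem_iInf, Module.End.mem_eigenspace_iff] at hx ⊢
      intro i hi
      rw [← Module.End.mul_apply, (hf i j).eq, Module.End.mul_apply, hx i hi, map_smul]
    have : Nontrivial W := Submodule.nontrivial_iff_ne_bot.2 hχ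
    obtain ⟨μ, hμ⟩ := Module.End.exists_eigenvalue ((f j).restrict hinv)
    obtain ⟨v, hv⟩ := hμ.exists_hasEigenvector
    refine ⟨Function.update χ j μ, (Submodule.ne_bot_iff _).2 ⟨v, ?_, ?_⟩⟩
    · simp only [Submodule.mem_iInf, Module.End.mem_eigenspace_iff, Finset.mem_insert]
      rintro i (rfl | hi)
      · simpa using congrArg Subtype.val hv.apply_eq_smul
      · have := v.2
        simp only [hW, Submodule.mem_iInf, Module.End.mem_eigenspace_iff] at this
        rw [Function.update_of_ne (ne_of_mem_of_not_mem hi hj), this i hi]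
    · simpa using hv.2

/-! ### The trace character -/

open ComplexOrder in
theorem eq_zero_of_star_dotProduct_self {ι : Type*} [Fintype ι] {v : ι → ℂ}
    (h : star v ⬝ᵥ v = 0) : v = 0 :=
  dotProduct_star_self_eq_zero.1 h

section TraceChar

variable (p : ℕ) [Fact p.Prime] {F : Type*} [Field F] [Algebra (ZMod p) F]

/-- The additive character `x ↦ exp(2πi tr(x)/p)`. -/
noncomputable def traceChar (F : Type*) [Field F] [Algebra (ZMod p) F] : AddChar F ℂ :=
  ZMod.stdAddChar.compAddMonoidHom (Algebra.trace (ZMod p) F).toAddMonoidHom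

theorem traceChar_apply (x : F) :
    traceChar p F x = ZMod.stdAddChar (Algebra.trace (ZMod p) F x) := rfl

theorem traceChar_ne_zero [Fintype F] : traceChar p F ≠ 0 := by
  intro h
  obtain ⟨x, hx⟩ := Algebra.trace_surjective (ZMod p) F 1
  have h1 := DFunLike.congr_fun h x
  rw [traceChar_apply, hx, AddChar.zero_apply,
    ← AddChar.map_zero_eq_one (ZMod.stdAddChar (N := p))] at h1
  exact one_ne_zero (ZMod.injective_stdAddChar h1)

theorem traceChar_neg [Fintype F] (x : F) : traceChar p F (-x) = star (traceChar p F x) :=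
  AddChar.map_neg_eq_conj _ _

theorem star_traceChar_mul [Fintype F] (x : F) : star (traceChar p F x) * traceChar p F x = 1 := by
  rw [← traceChar_neg, ← AddChar.map_add_eq_mul, neg_add_cancel, AddChar.map_zero_eq_one]

theorem sum_traceChar_dotProduct [Fintype F] [DecidableEq F] {ι : Type*} [Fintype ι]
    [DecidableEq ι] (z : ι → F) :
    ∑ b : ι → F, traceChar p F (b ⬝ᵥ z) = if z = 0 then (Fintype.card (ι → F) : ℂ) else 0 := by
  split_ifs with hz
  · simp [hz]
  · obtain ⟨i, hi⟩ := Function.ne_iff.1 hz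
    let f : (ι → F) →+ F :=
      { toFun := fun b => b ⬝ᵥ z, map_zero' := zero_dotProduct _
        map_add' := fun a b => add_dotProduct _ _ _ }
    refine (AddChar.sum_eq_zero_iff_ne_zero (ψ := (traceChar p F).compAddMonoidHom f)).2 fun h => ?_
    refine traceChar_ne_zero p (F := F) ?_
    ext x
    -- This vector has dot product `x` with `z`, so a trivial character here would make `traceChar`
    -- trivial.
    have := DFunLike.congr_fun h (Pi.single i (x / z i))
    simpa [f, div_mul_cancel₀ _ hi] using this

end TraceChar

/-! ### Weyl operators -/

section QuantumCodes

variable (p : ℕ) [Fact p.Prime] {F : Type*} [Field F] [Fintype F] [DecidableEq F]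
  [Algebra (ZMod p) F] {N : ℕ}

theorem weylOp_apply (c : SympVec F N) (x y : Fin N → F) :
    weylOp p c x y = if x = y + c.1 then traceChar p F (c.2 ⬝ᵥ y) else 0 := rfl

theorem weylOp_zero : weylOp p (0 : SympVec F N) = 1 := by
  ext x y
  simp [weylOp_apply, Matrix.one_apply]

theorem weylOp_mul (c d : SympVec F N) :
    weylOp p c * weylOp p d = traceChar p F (c.2 ⬝ᵥ d.1) • weylOp p (c + d) := by
  ext x y
  have h : x = y + d.1 + c.1 ↔ x = y + (c.1 + d.1) := by rw [add_comm c.1, add_assoc]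
  simp only [Matrix.mul_apply, weylOp_apply, Matrix.smul_apply, smul_eq_mul, mul_ite, mul_zero,
    Finset.sum_ite_eq', Finset.mem_univ, if_true, Prod.fst_add, Prod.snd_add, h]
  split_ifs
  · rw [dotProduct_add, add_dotProduct, ← AddChar.map_add_eq_mul, ← AddChar.map_add_eq_mul]
    congr 1
    ring
  · rw [zero_mul]

theorem weylOp_comm {c d : SympVec F N} (h : sympInner c d = 0) :
    weylOp p c * weylOp p d = weylOp p d * weylOp p c := by
  rw [weylOp_mul, weylOp_mul, add_comm d, dotProduct_comm d.2, ← sub_eq_zero.1 h]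

theorem conjTranspose_weylOp_mul (c : SympVec F N) :
    (weylOp p c).conjTranspose * weylOp p c = 1 := by
  ext x y
  simp only [Matrix.mul_apply, Matrix.conjTranspose_apply, weylOp_apply, Matrix.one_apply,
    mul_ite, mul_zero, Finset.sum_ite_eq', Finset.mem_univ, if_true,
    add_left_inj, eq_comm (a := y)]
  split_ifs with h
  · rw [h, star_traceChar_mul]
  · simp

theorem trace_weylOp (c : SympVec F N) :
    (weylOp p c).trace = if c = 0 then (Fintype.card (Fin N → F) : ℂ) else 0 := by
  simp only [Matrix.trace, Matrix.diag, weylOp_apply]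
  by_cases h : c.1 = 0
  · simp_rw [h, add_zero, if_true, dotProduct_comm c.2, sum_traceChar_dotProduct]
    simp [Prod.ext_iff, h]
  · rw [if_neg fun hc => h (congrArg Prod.fst hc)]
    exact Finset.sum_eq_zero fun x _ => if_neg (by simpa using h)

theorem mulVec_weylOp_ne_zero (c : SympVec F N) {v : QSpace F N} (hv : v ≠ 0) :
    (weylOp p c).mulVec v ≠ 0 := by
  intro h
  apply hv
  rw [← Matrix.one_mulVec v, ← conjTranspose_weylOp_mul p c, ← Matrix.mulVec_mulVec, h,
    Matrix.mulVec_zero]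

theorem star_mulVec_dotProduct_mulVec_weylOp (c : SympVec F N) (u v : QSpace F N) :
    star ((weylOp p c).mulVec u) ⬝ᵥ (weylOp p c).mulVec v = star u ⬝ᵥ v := by
  rw [Matrix.star_mulVec, Matrix.dotProduct_mulVec, Matrix.vecMul_vecMul,
    conjTranspose_weylOp_mul, Matrix.vecMul_one]

/-! ### Stabilizer codes of self-orthogonal codes -/

/-- Scalars `γ c` for which the operators `γ c X(a)Z(b)`, `c = (a|b) ∈ D`, form a group of
unitary operators isomorphic to `D`. -/
structure IsPhase (D : Submodule F (SympVec F N)) (γ : SympVec F N → ℂ) : Prop where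
  zero : γ 0 = 1
  star_mul_self : ∀ c ∈ D, star (γ c) * γ c = 1
  mul : ∀ c ∈ D, ∀ d ∈ D, γ c * γ d * traceChar p F (c.2 ⬝ᵥ d.1) = γ (c + d)

/-- Take a common eigenvector `v` of the commuting Weyl operators and let `γ c` be the inverse
eigenvalue. All rescaled operators fix `v`, so no scalar can survive in their products; this treats
even and odd `p` alike. -/
theorem exists_isPhase {D : Submodule F (SympVec F N)} (hD : D ≤ sympDual D) :
    ∃ γ, IsPhase p D γ := by
  classical
  obtain ⟨χ, v, hv, hχ⟩ := Module.End.exists_joint_eigenvector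
    (fun c : D => Matrix.toLin' (weylOp p (c : SympVec F N)))
    (fun c d => by
      rw [Commute, SemiconjBy, Module.End.mul_eq_comp, Module.End.mul_eq_comp, ← Matrix.toLin'_mul,
        ← Matrix.toLin'_mul,
        weylOp_comm p (hD d.2 c c.2)]) Finset.univ
  have hχ' (c : SympVec F N) (hc : c ∈ D) : (weylOp p c).mulVec v = χ ⟨c, hc⟩ • v := by
    simpa using hχ ⟨c, hc⟩ (Finset.mem_univ _)
  have hne (c) : χ c ≠ 0 := fun h => mulVec_weylOp_ne_zero p (c : SympVec F N) hv (by
    rw [hχ' _ c.2, Subtype.coe_eta, h, zero_smul])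
  have hinj {a b : ℂ} (h : a • v = b • v) : a = b := smul_left_injective ℂ hv h
  refine ⟨fun c => if h : c ∈ D then (χ ⟨c, h⟩)⁻¹ else 0, ?_, fun c hc => ?_,
    fun c hc d hd => ?_⟩
  · have : (1 : ℂ) • v = χ ⟨0, D.zero_mem⟩ • v := by
      rw [← hχ' 0 D.zero_mem, weylOp_zero, Matrix.one_mulVec, one_smul]
    simp [D.zero_mem, ← hinj this]
  -- Weyl operators are unitary, so their eigenvalues have modulus one.
  · have h1 := star_mulVec_dotProduct_mulVec_weylOp p c v v
    rw [hχ' c hc, star_smul, smul_dotProduct, dotProduct_smul, smul_eq_mul, smul_eq_mul,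
      ← mul_assoc, mul_eq_right₀ (fun h => hv (eq_zero_of_star_dotProduct_self h))] at h1
    simp only [hc, dif_pos]
    rw [star_inv₀, ← mul_inv, h1, inv_one]
  · simp only [hc, hd, D.add_mem hc hd, dif_pos]
    have h1 : (χ ⟨c, hc⟩ * χ ⟨d, hd⟩) • v =
        (traceChar p F (c.2 ⬝ᵥ d.1) * χ ⟨c + d, D.add_mem hc hd⟩) • v := by
      rw [mul_smul (traceChar p F _), ← hχ' (c + d) (D.add_mem hc hd), ← Matrix.smul_mulVec,
        ← weylOp_mul, ← Matrix.mulVec_mulVec, hχ' d hd, Matrix.mulVec_smul, hχ' c hc, smul_smul,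
        mul_comm]
    have h2 := hinj h1
    have h3 := hne ⟨c, hc⟩
    have h4 := hne ⟨d, hd⟩
    have h5 := hne ⟨c + d, D.add_mem hc hd⟩
    field_simp
    rw [h2, mul_comm]

/-- The joint `+1`-eigenspace of the operators `γ c X(a)Z(b)`, `c = (a|b) ∈ D`. -/
def stabilizerCode (D : Submodule F (SympVec F N)) (γ : SympVec F N → ℂ) :
    Submodule ℂ (QSpace F N) where
  carrier := {v | ∀ c ∈ D, (γ c • weylOp p c).mulVec v = v}
  zero_mem' c _ := Matrix.mulVec_zero _
  add_mem' hu hv c hc := by rw [Matrix.mulVec_add, hu c hc, hv c hc]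
  smul_mem' a v hv c hc := by rw [Matrix.mulVec_smul, hv c hc]

/-- The average of the operators `γ c X(a)Z(b)`, `c = (a|b) ∈ D`. -/
noncomputable def stabilizerProj (D : Submodule F (SympVec F N)) (γ : SympVec F N → ℂ) :
    QOp F N :=
  (Nat.card D : ℂ)⁻¹ • ∑ᶠ c : D, γ c • weylOp p (c : SympVec F N)

variable {p} {D : Submodule F (SympVec F N)} {γ : SympVec F N → ℂ}

/-- Only the Weyl operator of the zero vector has non-zero trace, and `c + d = 0` with `d ∈ D` would
put `c` in `D`. -/
theorem trace_weylOp_mul_stabilizerProj {c : SympVec F N} (hc : c ∉ D) :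
    (weylOp p c * stabilizerProj p D γ).trace = 0 := by
  classical
  rw [stabilizerProj, Matrix.mul_smul, finsum_eq_sum_of_fintype, Finset.mul_sum,
    Matrix.trace_smul, Matrix.trace_sum, Finset.sum_eq_zero, smul_zero]
  intro d _
  rw [Matrix.mul_smul, weylOp_mul, Matrix.trace_smul, Matrix.trace_smul, trace_weylOp, if_neg,
    smul_zero, smul_zero]
  intro h
  exact hc (eq_neg_of_add_eq_zero_left h ▸ D.neg_mem d.2)

namespace IsPhase

theorem smul_weylOp_mul (hγ : IsPhase p D γ) {c d : SympVec F N} (hc : c ∈ D)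
    (hd : d ∈ D) :
    (γ c • weylOp p c) * (γ d • weylOp p d) = γ (c + d) • weylOp p (c + d) := by
  rw [smul_mul_smul_comm, weylOp_mul, smul_smul, hγ.mul c hc d hd]

theorem star_mulVec_dotProduct_mulVec (hγ : IsPhase p D γ) {c : SympVec F N} (hc : c ∈ D)
    (u v : QSpace F N) :
    star ((γ c • weylOp p c).mulVec u) ⬝ᵥ (γ c • weylOp p c).mulVec v = star u ⬝ᵥ v := by
  rw [Matrix.smul_mulVec, Matrix.smul_mulVec, star_smul, smul_dotProduct, dotProduct_smul,
    star_mulVec_dotProduct_mulVec_weylOp, smul_smul, smul_eq_mul, hγ.star_mul_self c hc, one_mul]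

theorem smul_weylOp_mul_stabilizerProj (hγ : IsPhase p D γ) {c : SympVec F N}
    (hc : c ∈ D) :
    (γ c • weylOp p c) * stabilizerProj p D γ = stabilizerProj p D γ := by
  classical
  rw [stabilizerProj, Matrix.mul_smul, finsum_eq_sum_of_fintype, Finset.mul_sum]
  congr 1
  refine Fintype.sum_equiv (Equiv.addLeft ⟨c, hc⟩) _ _ fun d => ?_
  rw [hγ.smul_weylOp_mul hc d.2]
  rfl

theorem isProj_stabilizerProj (hγ : IsPhase p D γ) :
    LinearMap.IsProj (stabilizerCode p D γ) (Matrix.toLin' (stabilizerProj p D γ)) := by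
  classical
  refine ⟨fun v c hc => ?_, fun v hv => ?_⟩
  · rw [Matrix.toLin'_apply, Matrix.mulVec_mulVec, hγ.smul_weylOp_mul_stabilizerProj hc]
  · rw [Matrix.toLin'_apply, stabilizerProj, finsum_eq_sum_of_fintype, Matrix.smul_mulVec,
      Matrix.sum_mulVec, Finset.sum_congr rfl fun c _ => hv c.1 c.2]
    rw [Finset.sum_const, Finset.card_univ, Nat.card_eq_fintype_card, ← Nat.cast_smul_eq_nsmul ℂ,
      smul_smul, inv_mul_cancel₀ (by simp), one_smul]

theorem trace_stabilizerProj (hγ : IsPhase p D γ) :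
    (stabilizerProj p D γ).trace = (Nat.card D : ℂ)⁻¹ * Fintype.card (Fin N → F) := by
  classical
  rw [stabilizerProj, finsum_eq_sum_of_fintype, Matrix.trace_smul, Matrix.trace_sum, smul_eq_mul]
  congr 1
  rw [Finset.sum_eq_single (0 : D)]
  · simp [hγ.zero, trace_weylOp]
  · intro d _ hd
    rw [Matrix.trace_smul, trace_weylOp, if_neg (by simpa using hd), smul_zero]
  · simp

theorem trace_stabilizerProj_eq_finrank (hγ : IsPhase p D γ) :
    (stabilizerProj p D γ).trace = Module.finrank ℂ (stabilizerCode p D γ) := by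
  rw [← hγ.isProj_stabilizerProj.trace, Matrix.trace_toLin'_eq]

/-- The rank of a projection is its trace, and in the average only `c = 0` contributes, which gives
`q^N / |D|`. -/
theorem finrank_stabilizerCode (hγ : IsPhase p D γ) (hD : Module.finrank F D ≤ N) :
    Module.finrank ℂ (stabilizerCode p D γ) = Fintype.card F ^ (N - Module.finrank F D) := by
  have h := hγ.trace_stabilizerProj.symm.trans hγ.trace_stabilizerProj_eq_finrank
  rw [Module.natCard_eq_pow_finrank (K := F), Nat.card_eq_fintype_card, Fintype.card_pi_const] at h
  have h0 : (Fintype.card F : ℂ) ≠ 0 := by simp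
  push_cast at h
  rw [mul_comm, ← pow_sub₀ _ h0 hD] at h
  exact_mod_cast h.symm

theorem isStabilizerCodeOf (hγ : IsPhase p D γ) (hD : Module.finrank F D ≤ N) :
    IsStabilizerCodeOf p (D : Set (SympVec F N)) (stabilizerCode p D γ) := by
  refine ⟨fun h => ?_, ?_⟩
  · have := hγ.finrank_stabilizerCode hD
    rw [h, finrank_bot] at this
    exact pow_ne_zero _ Fintype.card_ne_zero this.symm
  · let ρ : Multiplicative D →* QOp F N :=
      { toFun := fun c => γ c.toAdd • weylOp p (c.toAdd : SympVec F N)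
        map_one' := by simp [hγ.zero, weylOp_zero]
        map_mul' := fun c d => (hγ.smul_weylOp_mul c.toAdd.2 d.toAdd.2).symm }
    refine ⟨ρ.toHomUnits.range, ?_, fun c hc => ?_, fun v => ?_⟩
    · rintro _ ⟨c, rfl⟩
      exact ⟨c.toAdd, c.toAdd.2, γ c.toAdd, rfl⟩
    · exact ⟨_, ⟨Multiplicative.ofAdd ⟨c, hc⟩, rfl⟩, γ c, rfl⟩
    · refine ⟨?_, fun h c hc => h _ ⟨Multiplicative.ofAdd ⟨c, hc⟩, rfl⟩⟩
      rintro h _ ⟨c, rfl⟩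
      exact h _ c.toAdd.2

end IsPhase

end QuantumCodes

section Detection

variable {F : Type*} [Fintype F] [DecidableEq F] {N : ℕ}

/-! ### Detectable errors -/

/-- The errors which are detected by a code form a subspace. -/
noncomputable def detectable (Q : Submodule ℂ (QSpace F N)) : Submodule ℂ (QOp F N) where
  carrier := {E | Detects Q E}
  zero_mem' := ⟨0, fun u _ v _ => by simp, fun _ => by simp⟩
  add_mem' := by
    rintro E₁ E₂ ⟨γ₁, h₁, t₁⟩ ⟨γ₂, h₂, t₂⟩
    refine ⟨γ₁ + γ₂, fun u hu v hv => ?_, fun h => ?_⟩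
    · rw [Matrix.add_mulVec, dotProduct_add, h₁ u hu v hv, h₂ u hu v hv, add_mul]
    · rw [t₁ h, t₂ h, Matrix.trace_add, add_div]
  smul_mem' := by
    rintro a E ⟨γ, h, t⟩
    refine ⟨a * γ, fun u hu v hv => ?_, fun h' => ?_⟩
    · rw [Matrix.smul_mulVec, dotProduct_smul, h u hu v hv, smul_eq_mul, mul_assoc]
    · rw [t h', Matrix.trace_smul, smul_eq_mul, mul_div_assoc]

theorem mem_detectable {Q : Submodule ℂ (QSpace F N)} {E : QOp F N} :
    E ∈ detectable Q ↔ Detects Q E := Iff.rfl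

end Detection

/-- Extension by zero of a vector indexed by the positions in `T`. -/
def zeroExtend {F : Type*} [Zero F] {N : ℕ} (T : Finset (Fin N)) (f : T → F) : Fin N → F :=
  fun i => if h : i ∈ T then f ⟨i, h⟩ else 0

theorem swt_zeroExtend_le {F : Type*} [Field F] [DecidableEq F] {N : ℕ} (T : Finset (Fin N))
    (a b : T → F) : swt (zeroExtend T a, zeroExtend T b) ≤ T.card := by
  refine Finset.card_le_card fun i hi => ?_
  by_contra h
  simp [zeroExtend, h] at hi

theorem zeroExtend_dotProduct {F : Type*} [CommRing F] {N : ℕ} (T : Finset (Fin N)) (f : T → F)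
    (y : Fin N → F) : zeroExtend T f ⬝ᵥ y = f ⬝ᵥ fun i : T => y i := by
  have h (i : T) : f i = zeroExtend T f i := by simp [zeroExtend]
  simp only [dotProduct, h]
  rw [Finset.sum_coe_sort T fun i => zeroExtend T f i * y i]
  refine (Finset.sum_subset T.subset_univ fun i _ hi => ?_).symm
  rw [zeroExtend, dif_neg hi, zero_mul]

theorem eq_add_zeroExtend_iff {F : Type*} [AddCommGroup F] {N : ℕ} (T : Finset (Fin N))
    (s : T → F) (x y : Fin N → F) :
    x = y + zeroExtend T (s - fun i : T => y i) ↔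
      (∀ i, i ∉ T → x i = y i) ∧ (fun i : T => x i) = s := by
  constructor
  · intro h
    refine ⟨fun i hi => ?_, funext fun i => ?_⟩
    · rw [h]; simp [zeroExtend, hi]
    · rw [h]; simp [zeroExtend]
  · rintro ⟨h, rfl⟩
    ext i
    by_cases hi : i ∈ T
    · simp [zeroExtend, hi]
    · simp [zeroExtend, hi, h i hi]

/-! ### Weyl expansion of local operators and the distance of stabilizer codes -/

section QuantumCodes

variable (p : ℕ) [Fact p.Prime] {F : Type*} [Field F] [Fintype F] [DecidableEq F]
  [Algebra (ZMod p) F] {N : ℕ}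

theorem actsOn_weylOp (c : SympVec F N) :
    ActsOn (Finset.univ.filter fun i : Fin N => (c.1 i, c.2 i) ≠ (0, 0)) (weylOp p c) := by
  set T := Finset.univ.filter fun i : Fin N => (c.1 i, c.2 i) ≠ (0, 0) with hT
  have h0 {i} (hi : i ∉ T) : c.1 i = 0 ∧ c.2 i = 0 := by simpa [hT] using hi
  have h2 : c.2 = zeroExtend T fun i : T => c.2 i := by
    ext i
    by_cases hi : i ∈ T <;> simp [zeroExtend, hi]
    exact (h0 hi).2
  refine ⟨Matrix.of fun s t => if s = t + (fun i : T => c.1 i) then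
    traceChar p F ((fun i : T => c.2 i) ⬝ᵥ t) else 0, fun x y => ?_⟩
  rw [weylOp_apply, h2, zeroExtend_dotProduct, Matrix.of_apply, ← ite_and]
  refine if_congr ?_ (by simp [zeroExtend]) rfl
  constructor
  · rintro rfl
    exact ⟨fun i hi => by simp [h0 hi], rfl⟩
  · rintro ⟨h1, h3⟩
    ext i
    by_cases hi : i ∈ T
    · exact congrFun h3 ⟨i, hi⟩
    · simp [h1 i hi, h0 hi]

/-- The matrix unit `|s⟩⟨t|` on the factors in `T` is `X(s - t)` times `|t⟩⟨t|`, and by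
orthogonality of characters `|t⟩⟨t|` is the average over `b` of `Z(b)` with phase `exp(-2πi tr(b ·
t)/p)`. -/
theorem ActsOn.eq_sum_weylOp {T : Finset (Fin N)} {E : QOp F N} {A : Matrix (T → F) (T → F) ℂ}
    (hA : ∀ x y : Fin N → F,
      E x y = if ∀ i, i ∉ T → x i = y i then A (fun i => x i) (fun i => y i) else 0) :
    E = ∑ s : T → F, ∑ t : T → F, ∑ b : T → F,
      ((Fintype.card (T → F) : ℂ)⁻¹ * A s t * traceChar p F (b ⬝ᵥ -t)) •
        weylOp p (zeroExtend T (s - t), zeroExtend T b) := by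
  have hcard : (Fintype.card (T → F) : ℂ) ≠ 0 := by simp
  ext x y
  have hsum (s t : T → F) : ∑ b : T → F, ((Fintype.card (T → F) : ℂ)⁻¹ * A s t *
      traceChar p F (b ⬝ᵥ -t)) * weylOp p (zeroExtend T (s - t), zeroExtend T b) x y =
      if t = (fun i : T => y i) then
        if x = y + zeroExtend T (s - fun i : T => y i) then A s t else 0 else 0 := by
    have h1 (b : T → F) : ((Fintype.card (T → F) : ℂ)⁻¹ * A s t * traceChar p F (b ⬝ᵥ -t)) *
        weylOp p (zeroExtend T (s - t), zeroExtend T b) x y =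
        ((Fintype.card (T → F) : ℂ)⁻¹ * if x = y + zeroExtend T (s - t) then A s t else 0) *
          traceChar p F (b ⬝ᵥ ((fun i : T => y i) - t)) := by
      rw [weylOp_apply, zeroExtend_dotProduct, sub_eq_add_neg (fun i : T => y i), dotProduct_add,
        AddChar.map_add_eq_mul]
      split_ifs <;> ring
    simp_rw [h1]
    rw [← Finset.mul_sum, sum_traceChar_dotProduct]
    by_cases ht : t = fun i : T => y i
    · rw [if_pos ht, if_pos (sub_eq_zero.2 ht.symm), mul_comm, mul_inv_cancel_left₀ hcard, ht]
    · rw [if_neg ht, if_neg fun h => ht (sub_eq_zero.1 h).symm, mul_zero]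
  simp only [Matrix.sum_apply, Matrix.smul_apply, smul_eq_mul, hsum, Finset.sum_ite_eq',
    Finset.mem_univ, if_true, eq_add_zeroExtend_iff]
  rw [hA]
  by_cases h : ∀ i, i ∉ T → x i = y i
  · rw [if_pos h, Finset.sum_eq_single fun i : T => x i]
    · rw [if_pos ⟨h, rfl⟩]
    · exact fun s _ hs => if_neg fun h' => hs h'.2.symm
    · simp
  · rw [if_neg h]
    exact (Finset.sum_eq_zero fun s _ => if_neg fun h' => h h'.1).symm

/-- The minimum distance can be determined from the Weyl operators. -/
theorem isQuantumMinDist_of_isLeast {Q : Submodule ℂ (QSpace F N)} {B : Set (SympVec F N)}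
    (hB : ∀ c, Detects Q (weylOp p c) ↔ c ∉ B) {d : ℕ} (hd : IsLeast (swt '' B) d) :
    IsQuantumMinDist Q d := by
  refine ⟨fun T hT E hE => ?_, fun d' hd' => ?_⟩
  · obtain ⟨A, hA⟩ := hE
    rw [← mem_detectable, ActsOn.eq_sum_weylOp p hA]
    refine Submodule.sum_mem _ fun s _ => Submodule.sum_mem _ fun t _ => Submodule.sum_mem _
      fun b _ => Submodule.smul_mem _ _ ((hB _).2 fun h => ?_)
    exact (hT.trans_le (hd.2 ⟨_, h, rfl⟩)).not_ge (swt_zeroExtend_le T _ _)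
  -- An undetected Weyl operator of least weight acts only on its support, so no larger distance is
  -- possible.
  · obtain ⟨c, hc, rfl⟩ := hd.1
    by_contra h
    exact (hB c).1 (hd' _ (not_le.1 h) _ (actsOn_weylOp p c)) hc

variable {p} {D : Submodule F (SympVec F N)} {γ : SympVec F N → ℂ}

/-- Outside `D^⊥` the operator moves the code to an orthogonal space, which is detected. Inside `D`
it acts as a non-zero scalar, which is harmless unless the code is one-dimensional, where the trace
convention asks for the scalar `0` when `c ≠ 0`. On `D^⊥ \ D` it preserves the code but is not a
scalar there, since its trace on the code is zero. -/
theorem IsPhase.detects_weylOp_iff (hγ : IsPhase p D γ) (hD : Module.finrank F D ≤ N)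
    (c : SympVec F N) :
    Detects (stabilizerCode p D γ) (weylOp p c) ↔
      c ∉ {c | c ∈ sympDual D ∧ c ≠ 0 ∧ (c ∈ D → Module.finrank F D = N)} := by
  have hcard : (Fintype.card (Fin N → F) : ℂ) ≠ 0 := by simp
  have hW {c} (hc : c ∈ D) {v} (hv : v ∈ stabilizerCode p D γ) :
      (weylOp p c).mulVec v = star (γ c) • v := by
    conv_rhs => rw [← hv c hc, Matrix.smul_mulVec, smul_smul, hγ.star_mul_self c hc, one_smul]
  have hF : 1 < Fintype.card F := Fintype.one_lt_card
  constructor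
  · rintro ⟨g, hg, ht⟩ ⟨hcD, hc0, hc⟩
    have hmem {v} (hv : v ∈ stabilizerCode p D γ) :
        (weylOp p c).mulVec v ∈ stabilizerCode p D γ := by
      intro a ha
      have h := weylOp_comm p (hcD a ha)
      rw [Matrix.mulVec_mulVec, Matrix.smul_mul, h, ← Matrix.mul_smul, ← Matrix.mulVec_mulVec,
        hv a ha]
    -- The difference of the two sides lies in the code, so the detection identity makes it
    -- orthogonal to itself.
    have hscal {v} (hv : v ∈ stabilizerCode p D γ) : (weylOp p c).mulVec v = g • v := by
      have h1 := Submodule.sub_mem _ (hmem hv) (Submodule.smul_mem _ g hv)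
      have h2 := hg _ h1 v hv
      rw [← smul_eq_mul, ← dotProduct_smul, ← sub_eq_zero, ← dotProduct_sub] at h2
      exact sub_eq_zero.1 (eq_zero_of_star_dotProduct_self h2)
    have hg0 : g = 0 := by
      by_cases h : c ∈ D
      · rw [ht (by rw [hγ.finrank_stabilizerCode hD, hc h, Nat.sub_self, pow_zero]),
          trace_weylOp, if_neg hc0, zero_div]
      · have h1 : weylOp p c * stabilizerProj p D γ = g • stabilizerProj p D γ := by
          refine Matrix.toLin'.injective (LinearMap.ext fun v => ?_)
          rw [Matrix.toLin'_apply, Matrix.toLin'_apply, ← Matrix.mulVec_mulVec,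
            Matrix.smul_mulVec]
          exact hscal (hγ.isProj_stabilizerProj.map_mem v)
        have h2 := trace_weylOp_mul_stabilizerProj (p := p) (γ := γ) h
        rw [h1, Matrix.trace_smul, hγ.trace_stabilizerProj_eq_finrank,
          hγ.finrank_stabilizerCode hD, smul_eq_mul] at h2
        simpa using h2
    obtain ⟨v, hv, hv0⟩ := Submodule.exists_mem_ne_zero_of_ne_bot (hγ.isStabilizerCodeOf hD).1
    exact mulVec_weylOp_ne_zero p c hv0 (by rw [hscal hv, hg0, zero_smul])
  · intro h
    by_cases hc0 : c = 0
    · refine ⟨1, fun u _ v _ => ?_, fun _ => ?_⟩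
      · rw [hc0, weylOp_zero, Matrix.one_mulVec, one_mul]
      · rw [hc0, trace_weylOp, if_pos rfl, div_self hcard]
    by_cases hcD : c ∈ sympDual D
    · have h1 : c ∈ D ∧ Module.finrank F D ≠ N := by
        by_contra h2
        exact h ⟨hcD, hc0, fun h3 => by_contra fun h4 => h2 ⟨h3, h4⟩⟩
      refine ⟨star (γ c), fun u _ v hv => ?_, fun h2 => ?_⟩
      · rw [hW h1.1 hv, dotProduct_smul, smul_eq_mul]
      · rw [hγ.finrank_stabilizerCode hD] at h2
        exact absurd h2 (Nat.one_lt_pow (Nat.sub_ne_zero_of_lt (lt_of_le_of_ne hD h1.2)) hF).ne'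
    · refine ⟨0, fun u hu v hv => ?_, fun _ => by rw [trace_weylOp, if_neg hc0, zero_div]⟩
      rw [zero_mul]
      simp only [mem_sympDual, not_forall] at hcD
      obtain ⟨a, ha, hac⟩ := hcD
      -- rescaling `a` makes the commutation phase of `a` and `c` non-trivial
      obtain ⟨x, hx⟩ : ∃ x : F, traceChar p F x ≠ 1 := by
        by_contra! hall
        exact traceChar_ne_zero p (F := F) (DFunLike.ext _ _ hall)
      set a' := (x / sympInner a c) • a with ha'
      have haD : a' ∈ D := D.smul_mem _ ha
      have hax : sympInner a' c = x := by
        rw [ha', sympInner_smul_left, div_mul_cancel₀ _ hac]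
      have hcomm : weylOp p c * weylOp p a' = traceChar p F x • (weylOp p a' * weylOp p c) := by
        rw [weylOp_mul, weylOp_mul, smul_smul, ← AddChar.map_add_eq_mul, add_comm a' c, ← hax,
          sympInner, dotProduct_comm a'.1]
        congr 2
        ring
      -- Applying the unitary stabilizer element of `a'` to both arguments fixes `u` and multiplies
      -- the other argument by a scalar different from `1`, so the inner product vanishes.
      have h1 := hγ.star_mulVec_dotProduct_mulVec haD u ((weylOp p c).mulVec v)
      have h2 : (γ a' • weylOp p a').mulVec ((weylOp p c).mulVec v) =
          star (traceChar p F x) • (weylOp p c).mulVec v := by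
        conv_rhs => rw [← hv a' haD]
        rw [Matrix.mulVec_mulVec, Matrix.mulVec_mulVec, Matrix.mul_smul, hcomm, smul_comm,
          Matrix.smul_mulVec, smul_smul, star_traceChar_mul, one_smul, Matrix.smul_mul]
      rw [h2, hu a' haD, dotProduct_smul, smul_eq_mul] at h1
      by_contra hne
      have h3 : star (traceChar p F x) = 1 := mul_eq_right₀ hne |>.1 h1
      exact hx (by rw [← star_star (traceChar p F x), h3, star_one])

end QuantumCodes

/-! ### Symplectic weights -/

section Weights

variable {F : Type*} [Field F] {n e : ℕ}

theorem swt_le [DecidableEq F] (x : SympVec F n) : swt x ≤ n :=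
  (Finset.card_filter_le _ _).trans (by simp)

theorem swt_pos [DecidableEq F] {x : SympVec F n} (hx : x ≠ 0) : 0 < swt x := by
  rw [swt, Finset.card_pos]
  by_contra h
  rw [Finset.not_nonempty_iff_eq_empty, Finset.filter_eq_empty_iff] at h
  simp only [Finset.mem_univ, true_implies, not_not, Prod.mk.injEq] at h
  exact hx (Prod.ext (funext fun i => (h (x := i)).1) (funext fun i => (h (x := i)).2))

theorem swt_appendVec [DecidableEq F] (x : SympVec F n) (s : SympVec F e) :
    swt (appendVec x s) = swt x + swt s := by
  rw [swt, Finset.card_filter, Fin.sum_univ_add, swt, Finset.card_filter, swt, Finset.card_filter]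
  simp [appendVec]

theorem swt_zero [DecidableEq F] : swt (0 : SympVec F n) = 0 := by
  simp [swt]

theorem minOrLength_le {W : Set ℕ} (hW : ∀ w ∈ W, w ≤ n) : minOrLength n W ≤ n := by
  rw [minOrLength]
  split_ifs with h
  · exact hW _ (Nat.sInf_mem h)
  · exact le_rfl

theorem minOrLength_le_of_mem {W : Set ℕ} {w : ℕ} (hw : w ∈ W) : minOrLength n W ≤ w := by
  rw [minOrLength, if_pos ⟨w, hw⟩]
  exact Nat.sInf_le hw

theorem swtSet_le_swt [DecidableEq F] {S : Set (SympVec F n)} {x : SympVec F n} (hx : x ∈ S)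
    (h0 : x ≠ 0) :
    swtSet S ≤ swt x :=
  minOrLength_le_of_mem ⟨x, hx, h0, rfl⟩

theorem swtSet_eq [DecidableEq F] (S : Set (SympVec F n)) :
    (swtSet S = n ∧ ∀ x ∈ S, x = 0) ∨ ∃ x ∈ S, x ≠ 0 ∧ swt x = swtSet S := by
  rw [swtSet, minOrLength]
  split_ifs with h
  · exact Or.inr (Nat.sInf_mem h)
  · refine Or.inl ⟨rfl, fun x hx => by_contra fun h0 => h ⟨_, x, hx, h0, rfl⟩⟩

theorem sympDist_le [DecidableEq F] (S : Set (SympVec F n)) : sympDist S ≤ n :=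
  minOrLength_le fun _ ⟨_, _, _, _, _, h⟩ => h ▸ swt_le _

theorem sympDist_le_swt [DecidableEq F] {M : Submodule F (SympVec F n)} {x : SympVec F n} (hx : x ∈ M)
    (h0 : x ≠ 0) : sympDist (M : Set (SympVec F n)) ≤ swt x :=
  minOrLength_le_of_mem ⟨x, hx, 0, M.zero_mem, h0, by rw [sub_zero]⟩

theorem sympDist_le_swtSet [DecidableEq F] {M : Submodule F (SympVec F n)} {S : Set (SympVec F n)}
    (hS : S ⊆ M) : sympDist (M : Set (SympVec F n)) ≤ swtSet S := by
  -- If `S` has no non-zero vector, the right side is the default `n`, which bounds every distance.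
  obtain ⟨h, -⟩ | ⟨x, hx, h0, h⟩ := swtSet_eq S
  · exact (sympDist_le _).trans h.ge
  · exact (sympDist_le_swt (hS hx) h0).trans h.le

/-! ### Non-detectable vectors -/

/-- The vectors whose Weyl operators are not detected by a stabilizer code of `D`. -/
def undetected (D : Submodule F (SympVec F n)) : Set (SympVec F n) :=
  {c | c ∈ sympDual D ∧ c ≠ 0 ∧ (c ∈ D → Module.finrank F D = n)}

theorem undetected_nonempty {D : Submodule F (SympVec F n)} (hn : 0 < n) (hD : D ≤ sympDual D) :
    (undetected D).Nonempty := by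
  have h := finrank_add_finrank_sympDual D
  by_cases hr : Module.finrank F D = n
  · have hne : D ≠ ⊥ := by
      rintro rfl
      rw [finrank_bot] at hr
      omega
    obtain ⟨x, hx, h0⟩ := Submodule.exists_mem_ne_zero_of_ne_bot hne
    exact ⟨x, hD hx, h0, fun _ => hr⟩
  · have hlt : D < sympDual D := lt_of_le_of_ne hD fun heq => hr (by rw [← heq] at h; omega)
    obtain ⟨x, hx, hxD⟩ := SetLike.exists_of_lt hlt
    exact ⟨x, hx, fun h0 => hxD (h0 ▸ D.zero_mem), fun h => absurd h hxD⟩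

theorem exists_isLeast_swt_undetected [DecidableEq F] {D : Submodule F (SympVec F n)} (hn : 0 < n)
    (hD : D ≤ sympDual D) : ∃ d, IsLeast (swt '' undetected D) d :=
  ⟨_, isLeast_csInf ((undetected_nonempty hn hD).image swt)⟩

/-- A vector not in `C^⊥` gains weight in the extension. -/
theorem swt_lt_swt_extendVec [DecidableEq F] {C : Submodule F (SympVec F n)}
    {z w : Fin e → SympVec F n}
    (hC : Submodule.span F (Set.range z ∪ Set.range w) ⊔ sympHull C = C) {x : SympVec F n}
    (hx : x ∈ C ⊔ sympDual C) (hxd : x ∉ sympDual C) : swt x + 1 ≤ swt (extendVec z w x) := by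
  rw [extendVec_apply, swt_appendVec, add_le_add_iff_left]
  -- A zero appended part means zero coefficients, and `C + C^⊥` is orthogonal to the hull, so `x`
  -- would lie in `C^⊥`.
  refine swt_pos fun h => hxd (mem_sympDual_of_pairCoeff_eq_zero hC
    (sup_le (le_sympDual_sympHull C) (sympDual_antitone inf_le_left) hx) ?_)
  have h1 := congrArg Prod.fst h
  have h2 := congrArg Prod.snd h
  exact Prod.ext h1 (neg_eq_zero.1 h2)

theorem swt_le_swt_extendVec [DecidableEq F] (z w : Fin e → SympVec F n) (x : SympVec F n) :
    swt x ≤ swt (extendVec z w x) := by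
  rw [extendVec_apply, swt_appendVec]
  exact Nat.le_add_right _ _

theorem mem_undetected_map_extendVec {C : Submodule F (SympVec F n)}
    {z w : Fin e → SympVec F n}
    (h : IsSymplecticPairs z w)
    (hC : Submodule.span F (Set.range z ∪ Set.range w) ⊔ sympHull C = C)
    {c : SympVec F (n + e)} :
    c ∈ undetected (C.map (extendVec z w)) ↔ ∃ x ∈ C ⊔ sympDual C, x ≠ 0 ∧
      (x ∈ C → Module.finrank F C = n + e) ∧ extendVec z w x = c := by
  have hinj := extendVec_injective z w
  rw [undetected, sympDual_map_extendVec h hC, finrank_map_extendVec]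
  constructor
  · rintro ⟨⟨x, hx, rfl⟩, h0, h1⟩
    exact ⟨x, hx, fun h => h0 (by rw [h, map_zero]),
      fun h => h1 (Submodule.mem_map_of_mem h), rfl⟩
  · rintro ⟨x, hx, h0, h1, rfl⟩
    refine ⟨Submodule.mem_map_of_mem hx, (map_ne_zero_iff _ hinj).2 h0, fun h => h1 ?_⟩
    obtain ⟨y, hy, hyx⟩ := h
    exact hinj hyx ▸ hy

theorem finrank_sup_sympDual {C : Submodule F (SympVec F n)}
    {z w : Fin e → SympVec F n}
    (h : IsSymplecticPairs z w)
    (hC : Submodule.span F (Set.range z ∪ Set.range w) ⊔ sympHull C = C) :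
    Module.finrank F C + Module.finrank F (C ⊔ sympDual C : Submodule F (SympVec F n)) =
      2 * (n + e) := by
  have h1 := finrank_eq_add_two_mul h hC
  have h2 := finrank_add_finrank_sympDual (sympHull C)
  rw [sympDual_sympHull h hC] at h2
  omega

/-- The dimensions of `C` and `C + C^⊥` add up to `2(n+e)`, so one of them is `n+e` exactly when the
two spaces coincide. -/
theorem finrank_eq_iff_sympDual_le {C : Submodule F (SympVec F n)}
    {z w : Fin e → SympVec F n}
    (h : IsSymplecticPairs z w)
    (hC : Submodule.span F (Set.range z ∪ Set.range w) ⊔ sympHull C = C) :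
    Module.finrank F C = n + e ↔ sympDual C ≤ C := by
  have h1 := finrank_sup_sympDual h hC
  constructor
  · intro h2
    have h3 := Submodule.eq_of_le_of_finrank_eq (le_sup_left : C ≤ C ⊔ sympDual C) (by omega)
    exact le_sup_right.trans h3.ge
  · intro h2
    rw [sup_eq_left.2 h2] at h1
    omega

theorem le_swt_of_mem_undetected_of_not_le [DecidableEq F] {C : Submodule F (SympVec F n)}
    {z w : Fin e → SympVec F n} (h : IsSymplecticPairs z w)
    (hC : Submodule.span F (Set.range z ∪ Set.range w) ⊔ sympHull C = C)
    (hle : ¬ sympDual C ≤ C) {c : SympVec F (n + e)}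
    (hc : c ∈ undetected (C.map (extendVec z w))) :
    min (swtSet ((sympDual C : Set (SympVec F n)) \ (sympHull C : Set (SympVec F n))))
      (swtSet (((C ⊔ sympDual C : Submodule F (SympVec F n)) : Set (SympVec F n)) \
        (C : Set (SympVec F n))) + 1) ≤ swt c := by
  obtain ⟨x, hx, h0, hxC, rfl⟩ := (mem_undetected_map_extendVec h hC).1 hc
  rw [finrank_eq_iff_sympDual_le h hC] at hxC
  have hxC' : x ∉ C := fun h => hle (hxC h)
  by_cases hxd : x ∈ sympDual C
  · exact (min_le_left _ _).trans ((swtSet_le_swt (S := _ \ _) ⟨hxd, fun h => hxC' h.1⟩ h0).trans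
      (swt_le_swt_extendVec z w x))
  · exact (min_le_right _ _).trans ((Nat.succ_le_succ
      (swtSet_le_swt (S := _ \ _) ⟨hx, hxC'⟩ h0)).trans (swt_lt_swt_extendVec hC hx hxd))

theorem le_swt_of_mem_undetected [DecidableEq F] {C : Submodule F (SympVec F n)}
    {z w : Fin e → SympVec F n} (h : IsSymplecticPairs z w)
    (hC : Submodule.span F (Set.range z ∪ Set.range w) ⊔ sympHull C = C)
    {c : SympVec F (n + e)} (hc : c ∈ undetected (C.map (extendVec z w))) :
    min (sympDist (sympDual C : Set (SympVec F n)))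
      (sympDist ((C ⊔ sympDual C : Submodule F (SympVec F n)) : Set (SympVec F n)) + 1) ≤
        swt c := by
  obtain ⟨x, hx, h0, -, rfl⟩ := (mem_undetected_map_extendVec h hC).1 hc
  by_cases hxd : x ∈ sympDual C
  · exact (min_le_left _ _).trans ((sympDist_le_swt hxd h0).trans (swt_le_swt_extendVec z w x))
  · exact (min_le_right _ _).trans ((Nat.succ_le_succ (sympDist_le_swt hx h0)).trans
      (swt_lt_swt_extendVec hC hx hxd))

/-- A least-weight vector of `C^⊥` outside the hull keeps its weight in the extension. If there is
none, the bound is the default `n` and the quantum code is one-dimensional, so any non-zero vector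
of `C^⊥` will do; `htop` supplies a witness when `C^⊥ = 0`. -/
theorem exists_mem_undetected_swt_le [DecidableEq F] {C : Submodule F (SympVec F n)}
    {z w : Fin e → SympVec F n} (h : IsSymplecticPairs z w)
    (hC : Submodule.span F (Set.range z ∪ Set.range w) ⊔ sympHull C = C)
    (htop : C = ⊤ → ∃ x : SympVec F n, x ≠ 0 ∧ swt (extendVec z w x) ≤ n) :
    ∃ c ∈ undetected (C.map (extendVec z w)),
      swt c ≤ swtSet ((sympDual C : Set (SympVec F n)) \ (sympHull C : Set (SympVec F n))) := by
  have hspan : Submodule.span F (Set.range z ∪ Set.range w) ≤ C := le_sup_left.trans hC.le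
  have hz i : z i ∈ C := hspan (Submodule.subset_span (Or.inl ⟨i, rfl⟩))
  have hw i : w i ∈ C := hspan (Submodule.subset_span (Or.inr ⟨i, rfl⟩))
  have hswt {x} (hx : x ∈ sympDual C) : swt (extendVec z w x) = swt x := by
    rw [extendVec_eq_of_pairCoeff_eq_zero (pairCoeff_eq_zero hz hw hx), swt_appendVec, swt_zero,
      add_zero]
  obtain ⟨hn, hall⟩ | ⟨x, hx, h0, hmin⟩ :=
    swtSet_eq ((sympDual C : Set (SympVec F n)) \ (sympHull C : Set (SympVec F n)))
  · have hle : sympDual C ≤ C := by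
      intro x hx
      by_contra hxC
      exact hxC (hall x ⟨hx, fun h => hxC h.1⟩ ▸ C.zero_mem)
    have hr := (finrank_eq_iff_sympDual_le h hC).2 hle
    rw [hn]
    by_cases hbot : sympDual C = ⊥
    · have hCtop : C = ⊤ := by
        have h1 := finrank_add_finrank_sympDual C
        rw [hbot, finrank_bot] at h1
        refine Submodule.eq_top_of_finrank_eq ?_
        rw [Module.finrank_prod, Module.finrank_fin_fun]
        omega
      obtain ⟨x, h0, hxn⟩ := htop hCtop
      exact ⟨_, (mem_undetected_map_extendVec h hC).2
        ⟨x, hCtop ▸ Submodule.mem_sup_left Submodule.mem_top, h0, fun _ => hr, rfl⟩, hxn⟩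
    · obtain ⟨x, hx, h0⟩ := Submodule.exists_mem_ne_zero_of_ne_bot hbot
      exact ⟨_, (mem_undetected_map_extendVec h hC).2
        ⟨x, Submodule.mem_sup_right hx, h0, fun _ => hr, rfl⟩, (hswt hx).trans_le (swt_le x)⟩
  · exact ⟨_, (mem_undetected_map_extendVec h hC).2
      ⟨x, Submodule.mem_sup_right hx.1, h0, fun hxC => absurd ⟨hxC, hx.1⟩ hx.2, rfl⟩,
      ((hswt hx.1).trans hmin).le⟩

theorem map_extendVec_le_sympDual {C : Submodule F (SympVec F n)}
    {z w : Fin e → SympVec F n}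
    (h : IsSymplecticPairs z w)
    (hC : Submodule.span F (Set.range z ∪ Set.range w) ⊔ sympHull C = C) :
    C.map (extendVec z w) ≤ sympDual (C.map (extendVec z w)) := by
  rw [sympDual_map_extendVec h hC]
  exact Submodule.map_mono le_sup_left

/-! ### Pairs of unit vectors -/

theorem isSymplecticPairs_single :
    IsSymplecticPairs (fun i : Fin n => ((Pi.single i 1, 0) : SympVec F n))
      (fun i => (0, Pi.single i 1)) := by
  intro i j
  simp [sympInner, Pi.single_apply, eq_comm]

theorem span_single_eq_top :
    Submodule.span F (Set.range (fun i : Fin n => ((Pi.single i 1, 0) : SympVec F n)) ∪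
      Set.range fun i : Fin n => ((0, Pi.single i 1) : SympVec F n)) = ⊤ := by
  refine Submodule.eq_top_of_finrank_eq ?_
  rw [finrank_span_pairs isSymplecticPairs_single, Module.finrank_prod, Module.finrank_fin_fun,
    two_mul]

theorem swt_single [DecidableEq F] (i : Fin n) (a b : F) :
    swt (Pi.single i a, Pi.single i b) ≤ 1 := by
  rw [← Finset.card_singleton i]
  refine Finset.card_le_card fun j hj => ?_
  by_contra h
  rw [Finset.mem_singleton] at h
  simp [Pi.single_eq_of_ne h] at hj

/-- The code of all vectors `(0|b)`. -/
def phaseCode (F : Type*) [Field F] (N : ℕ) : Submodule F (SympVec F N) :=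
  LinearMap.range (LinearMap.inr F (Fin N → F) (Fin N → F))

theorem finrank_phaseCode (N : ℕ) : Module.finrank F (phaseCode F N) = N := by
  rw [phaseCode, LinearMap.finrank_range_of_inj LinearMap.inr_injective, Module.finrank_fin_fun]

theorem phaseCode_le_sympDual (N : ℕ) : phaseCode F N ≤ sympDual (phaseCode F N) := by
  rintro _ ⟨a, rfl⟩ _ ⟨b, rfl⟩
  simp [sympInner]

/-- The code has dimension `N`, so its own non-zero vectors count as undetected, and it contains a
unit vector. This gives distance at most `1` in the exceptional case. -/
theorem exists_mem_undetected_phaseCode [DecidableEq F] {N : ℕ} (hN : 0 < N) :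
    ∃ c ∈ undetected (phaseCode F N), swt c ≤ 1 := by
  refine ⟨(0, Pi.single ⟨0, hN⟩ 1), ⟨phaseCode_le_sympDual N ⟨_, rfl⟩, ?_,
    fun _ => finrank_phaseCode N⟩, ?_⟩
  · simp [Prod.ext_iff]
  · simpa using swt_single ⟨0, hN⟩ (0 : F) 1

end Weights

/-! ### The main theorem -/

theorem exists_stabilizerCode (p : ℕ) [Fact p.Prime] {F : Type*} [Field F] [Fintype F]
    [DecidableEq F] [Algebra (ZMod p) F] {N : ℕ} (hN : 0 < N) {D : Submodule F (SympVec F N)}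
    (hD : D ≤ sympDual D) :
    ∃ (Q : Submodule ℂ (QSpace F N)) (d : ℕ), IsStabilizerCodeOf p (D : Set (SympVec F N)) Q ∧
      Module.finrank ℂ Q = Fintype.card F ^ (N - Module.finrank F D) ∧
      IsQuantumMinDist Q d ∧ IsLeast (swt '' undetected D) d := by
  have hr : Module.finrank F D ≤ N := by
    have h1 := finrank_add_finrank_sympDual D
    have h2 := Submodule.finrank_mono hD
    omega
  obtain ⟨γ, hγ⟩ := exists_isPhase p hD
  obtain ⟨d, hd⟩ := exists_isLeast_swt_undetected hN hD
  exact ⟨stabilizerCode p D γ, d, hγ.isStabilizerCodeOf hr, hγ.finrank_stabilizerCode hr,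
    isQuantumMinDist_of_isLeast p (hγ.detects_weylOp_iff hr) hd, hd⟩

theorem min_sympDist_le_min_swtSet {F : Type*} [Field F] [DecidableEq F] {n : ℕ}
    (C : Submodule F (SympVec F n)) :
    min (sympDist (sympDual C : Set (SympVec F n)))
        (sympDist ((C ⊔ sympDual C : Submodule F (SympVec F n)) : Set (SympVec F n)) + 1) ≤
      min (swtSet ((sympDual C : Set (SympVec F n)) \ (sympHull C : Set (SympVec F n))))
        (swtSet (((C ⊔ sympDual C : Submodule F (SympVec F n)) : Set (SympVec F n)) \
          (C : Set (SympVec F n))) + 1) :=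
  min_le_min (sympDist_le_swtSet Set.sdiff_subset)
    (Nat.succ_le_succ (sympDist_le_swtSet Set.sdiff_subset))

theorem mainTheorem2 {p : ℕ} [Fact p.Prime] {F : Type*} [Field F] [Fintype F] [DecidableEq F]
    [Algebra (ZMod p) F] {n k : ℕ} (hn : 0 < n)
    (C : Submodule F (SympVec F n)) (hk : Module.finrank F C = k) :
    ∃ e : ℕ, k = Module.finrank F (sympHull C) + 2 * e ∧ k ≤ n + e ∧
    ∃ z w : Fin e → SympVec F n,
      IsSymplecticPairs z w ∧
      Disjoint (Submodule.span F (Set.range z ∪ Set.range w)) (sympHull C) ∧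
      Submodule.span F (Set.range z ∪ Set.range w) ⊔ sympHull C = C ∧
    ∃ (D : Submodule F (SympVec F (n + e))) (Q : Submodule ℂ (QSpace F (n + e))) (d : ℕ),
      (¬ (n = 1 ∧ C = ⊤) → D = sympExtension (sympHull C) z w) ∧
      IsStabilizerCodeOf p (D : Set (SympVec F (n + e))) Q ∧
      Module.finrank ℂ Q = Fintype.card F ^ (n + e - k) ∧
      IsQuantumMinDist Q d ∧
      (¬ sympDual C ≤ C →
        min (swtSet ((sympDual C : Set (SympVec F n)) \ (sympHull C : Set (SympVec F n))))
          (swtSet (((C ⊔ sympDual C : Submodule F (SympVec F n)) : Set (SympVec F n)) \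
            (C : Set (SympVec F n))) + 1) ≤ d) ∧
      min (sympDist (sympDual C : Set (SympVec F n)))
          (sympDist ((C ⊔ sympDual C : Submodule F (SympVec F n)) : Set (SympVec F n)) + 1) ≤
        min (swtSet ((sympDual C : Set (SympVec F n)) \ (sympHull C : Set (SympVec F n))))
          (swtSet (((C ⊔ sympDual C : Submodule F (SympVec F n)) : Set (SympVec F n)) \
            (C : Set (SympVec F n))) + 1) ∧
      min (sympDist (sympDual C : Set (SympVec F n)))
          (sympDist ((C ⊔ sympDual C : Submodule F (SympVec F n)) : Set (SympVec F n)) + 1) ≤ d ∧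
      d ≤ swtSet ((sympDual C : Set (SympVec F n)) \ (sympHull C : Set (SympVec F n))) := by
  obtain ⟨e, z, w, hp, hC, htop⟩ : ∃ (e : ℕ) (z w : Fin e → SympVec F n),
      IsSymplecticPairs z w ∧
      Submodule.span F (Set.range z ∪ Set.range w) ⊔ sympHull C = C ∧
      (C = ⊤ → n ≠ 1 → ∃ x : SympVec F n, x ≠ 0 ∧ swt (extendVec z w x) ≤ n) := by
    by_cases hCtop : C = ⊤
    -- For `C = F^{2n}` the pairs are the standard ones, so a unit vector extends to weight at most
    -- `2`, which is at most `n` because `n ≠ 1`.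
    · refine ⟨n, _, _, isSymplecticPairs_single, by rw [span_single_eq_top, top_sup_eq, hCtop],
        fun _ h1 => ⟨(Pi.single ⟨0, hn⟩ 1, 0), by simp [Prod.ext_iff], ?_⟩⟩
      have h2 := extendVec_left (F := F) isSymplecticPairs_single ⟨0, hn⟩
      rw [h2, swt_appendVec]
      have h3 := swt_single ⟨0, hn⟩ (1 : F) 0
      rw [Pi.single_zero] at h3
      omega
    · obtain ⟨e, z, w, hp, hz, hw, hle⟩ := exists_symplecticPairs C
      refine ⟨e, z, w, hp, le_antisymm (sup_le (Submodule.span_le.2 ?_) inf_le_left) hle,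
        fun h => absurd h hCtop⟩
      rintro _ (⟨i, rfl⟩ | ⟨i, rfl⟩)
      exacts [hz i, hw i]
  have hspan : Submodule.span F (Set.range z ∪ Set.range w) ≤ C := le_sup_left.trans hC.le
  have hz i : z i ∈ C := hspan (Submodule.subset_span (Or.inl ⟨i, rfl⟩))
  have hw i : w i ∈ C := hspan (Submodule.subset_span (Or.inr ⟨i, rfl⟩))
  have hsup := finrank_sup_sympDual hp hC
  have hmono := Submodule.finrank_mono (le_sup_left : C ≤ C ⊔ sympDual C)
  have hke : k ≤ n + e := by omega
  have hN : 0 < n + e := by omega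
  refine ⟨e, hk ▸ finrank_eq_add_two_mul hp hC, hke, z, w, hp,
    disjoint_span_pairs_sympHull hp hz hw, hC, ?_⟩
  -- In this case every non-zero vector of the extension has weight `2`, above the default upper
  -- bound `n = 1`, so a code of distance `1` replaces it.
  by_cases hex : n = 1 ∧ C = ⊤
  · have hle : sympDual C ≤ C := hex.2 ▸ le_top
    have hr := (finrank_eq_iff_sympDual_le hp hC).2 hle
    obtain ⟨Q, d, hQ, hrank, hdist, hmin⟩ := exists_stabilizerCode p hN
      (phaseCode_le_sympDual (F := F) (n + e))
    rw [finrank_phaseCode] at hrank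
    obtain ⟨c, hc, hc1⟩ := exists_mem_undetected_phaseCode (F := F) hN
    have hd1 : d ≤ 1 := (hmin.2 ⟨c, hc, rfl⟩).trans hc1
    obtain ⟨c', hc', rfl⟩ := hmin.1
    have hd0 := swt_pos hc'.2.1
    refine ⟨phaseCode F (n + e), Q, _, fun h => absurd hex h, hQ, ?_, hdist,
      fun h => absurd hle h, min_sympDist_le_min_swtSet C, ?_, ?_⟩
    · rw [hrank, ← hk, hr]
    · have := sympDist_le (sympDual C : Set (SympVec F n))
      exact (min_le_left _ _).trans (by omega)
    -- The bound is either the default `n = 1` or the weight of a non-zero vector, so it is at least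
    -- `1`.
    · obtain ⟨h, -⟩ | ⟨x, -, h0, h⟩ :=
        swtSet_eq ((sympDual C : Set (SympVec F n)) \ (sympHull C : Set (SympVec F n)))
      · omega
      · have := swt_pos h0
        omega
  · obtain ⟨Q, d, hQ, hrank, hdist, hmin⟩ := exists_stabilizerCode p hN
      (map_extendVec_le_sympDual hp hC)
    rw [finrank_map_extendVec, hk] at hrank
    obtain ⟨c, hc, hcd⟩ := hmin.1
    obtain ⟨c', hc', hle⟩ := exists_mem_undetected_swt_le hp hC
      fun h => htop h fun h1 => hex ⟨h1, h⟩
    exact ⟨_, Q, d, fun _ => (sympExtension_sympHull hp hC).symm, hQ, hrank, hdist,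
      fun h => hcd ▸ le_swt_of_mem_undetected_of_not_le hp hC h hc, min_sympDist_le_min_swtSet C,
      hcd ▸ le_swt_of_mem_undetected hp hC hc, (hmin.2 ⟨c', hc', rfl⟩).trans hle⟩
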